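/- Data. For $j=1,2$ (two epochs) let $\alpha_j,\delta_j,\dot\alpha_j,\dot\delta_j\in\mathbb{R}$ (an attributable $\mathcal{A}_j$) and $\mathbf q_j,\dot{\mathbf q}_j\in\mathbb{R}^3$ (position and velocity of the observer) be given; the data space is $\mathbb{R}^{20}$. Put $\mathbf e^\rho_j=(\cos\delta_j\cos\alpha_j,\cos\delta_j\sin\alpha_j,\sin\delta_j)$, $\mathbf e^\alpha_j=(-\sin\alpha_j,\cos\alpha_j,0)$, $\mathbf e^\delta_j=(-\sin\delta_j\cos\alpha_j,-\sin\delta_j\sin\alpha_j,\cos\delta_j)$, $\boldsymbol\eta_j=\dot\alpha_j\cos\delta_j\,\mathbf e^\alpha_j+\dot\delta_j\,\mathbf e^\delta_j$. A property of the data is said to hold generically if it holds at every point of the data space where some real analytic function on $\mathbb{R}^{20}$, not identically zero, does not vanish (hence on an open dense set). Keplerian integrals. In variables $\rho_j,\dot\rho_j,u_j$ (where $u_j$ replaces $\mu/|\mathbf r_j|$) put $\mathbf r_j=\rho_j\mathbf e^\rho_j+\mathbf q_j$, $\dot{\mathbf r}_j=\dot\rho_j\mathbf e^\rho_j+\rho_j\boldsymbol\eta_j+\dot{\mathbf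 q}_j$, and $$\mathbf c_j=\mathbf r_j\times\dot{\mathbf r}_j,\qquad \mu\mathbf L_j=(|\dot{\mathbf r}_j|^2-u_j)\mathbf r_j-(\mathbf r_j\cdot\dot{\mathbf r}_j)\dot{\mathbf r}_j,\qquad \mathcal E_j=\tfrac12|\dot{\mathbf r}_j|^2-u_j .$$ Let $I\subseteq\mathbb{R}[\rho_1,\rho_2,\dot\rho_1,\dot\rho_2,u_1,u_2]$ be the ideal generated by the seven polynomials given by the components of $\mathbf c_1-\mathbf c_2$, the components of $\mu\mathbf L_1-\mu\mathbf L_2$, and $\mathcal E_1-\mathcal E_2$. The polynomial $\mathfrak u$. Put $\mathbf D_j=\mathbf q_j\times\mathbf e^\rho_j$, $\mathbf E_j=\mathbf e^\rho_j\times\boldsymbol\eta_j$, $\mathbf F_j=\mathbf q_j\times\boldsymbol\eta_j+\mathbf e^\rho_j\times\dot{\mathbf q}_j$, $\mathbf G_j=\mathbf q_j\times\dot{\mathbf q}_j$, and $$\mathbf J=\mathbf E_2\rho_2^2-\mathbf E_1\rho_1^2+\mathbf F_2\rho_2-\mathbf F_1\rho_1+\mathbf G_2-\mathbf G_1,\qquad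 q=(\mathbf D_1\times\mathbf D_2)\cdot\mathbf J\in\mathbb{R}[\rho_1,\rho_2].$$ Let $\boldsymbol\xi=\bigl[\mu(\mathbf L_1-\mathbf L_2)-(\mathcal E_1\mathbf r_1-\mathcal E_2\mathbf r_2)\bigr]\times(\mathbf r_1-\mathbf r_2)$, in which $u_1,u_2$ cancel out, with the substitution $$\dot\rho_1=\frac{(\mathbf J\times\mathbf D_2)\cdot(\mathbf D_1\times\mathbf D_2)}{|\mathbf D_1\times\mathbf D_2|^2},\qquad \dot\rho_2=\frac{(\mathbf J\times\mathbf D_1)\cdot(\mathbf D_1\times\mathbf D_2)}{|\mathbf D_1\times\mathbf D_2|^2},$$ so that $\boldsymbol\xi\in\mathbb{R}[\rho_1,\rho_2]^3$ (for $\mathbf D_1\times\mathbf D_2\neq\mathbf 0$), and put $p_1=\boldsymbol\xi\cdot\mathbf e^\rho_1$, $p_2=\boldsymbol\xi\cdot\mathbf e^\rho_2$. Finally let $$\mathfrak u=\gcd\bigl(\mathrm{Res}(p_1,q,\rho_1),\ \mathrm{Res}(p_2,q,\rho_1)\bigr)\in\mathbb{R}[\rho_2],$$ which is defined up to a nonzero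 constant factor. Theorem. For generic data, the polynomial $\mathfrak u$ has degree $9$ and (whichever constant factor is chosen in $\mathfrak u$) there are six distinct polynomials $\mathfrak g_1,\dots,\mathfrak g_6\in\mathbb{R}[\rho_1,\rho_2,\dot\rho_1,\dot\rho_2,u_1,u_2]$ which form a Groebner basis of $I$ for the lexicographic order with $\dot\rho_1\succ\dot\rho_2\succ u_1\succ u_2\succ\rho_1\succ\rho_2$ (that is, $\mathfrak g_1,\dots,\mathfrak g_6\in I$, and the leading term of every nonzero element of $I$ is divisible by the leading term of some $\mathfrak g_i$), with $\mathfrak g_6=\mathfrak u$. -/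

import Mathlib

open scoped Matrix Polynomial

noncomputable section

namespace Linkage

/-! ### The data -/

/-- The data at one epoch: the attributable `(α, δ, α', δ')` (right ascension, declination and
their rates), the position `q` and the velocity `q'` of the observer. -/
abbrev EpochData : Type := (Fin 4 → ℝ) × (Fin 3 → ℝ) × (Fin 3 → ℝ)

/-- The data at the two epochs. -/
abbrev LinkData : Type := EpochData × EpochData

/-- A property of the data is generic if it holds outside the zero set of some real analytic
function on the data space that does not vanish identically (so, in particular, on an open dense
set). -/
def Generic (P : LinkData → Prop) : Prop :=
  ∃ F : LinkData → ℝ, AnalyticOnNhd ℝ F Set.univ ∧ (∃ d, F d ≠ 0) ∧ ∀ d, F d ≠ 0 → P d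

namespace EpochData

variable (a : EpochData)

/-- Right ascension. -/
def ra : ℝ := a.1 0
/-- Declination. -/
def dec : ℝ := a.1 1
/-- Rate of the right ascension. -/
def raRate : ℝ := a.1 2
/-- Rate of the declination. -/
def decRate : ℝ := a.1 3
/-- Heliocentric position of the observer. -/
def obsPos : Fin 3 → ℝ := a.2.1
/-- Heliocentric velocity of the observer. -/
def obsVel : Fin 3 → ℝ := a.2.2

/-- The line of sight unit vector `e^ρ`. -/
def eRho : Fin 3 → ℝ :=
  ![Real.cos a.dec * Real.cos a.ra, Real.cos a.dec * Real.sin a.ra, Real.sin a.dec]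

/-- `e^α = (cos δ)⁻¹ ∂e^ρ/∂α`, after cancellation of `cos δ`. -/
def eAlpha : Fin 3 → ℝ := ![-Real.sin a.ra, Real.cos a.ra, 0]

/-- `e^δ = ∂e^ρ/∂δ`. -/
def eDelta : Fin 3 → ℝ :=
  ![-(Real.sin a.dec * Real.cos a.ra), -(Real.sin a.dec * Real.sin a.ra), Real.cos a.dec]

/-- The vector `η = α' cos δ e^α + δ' e^δ`. -/
def eta : Fin 3 → ℝ :=
  (a.raRate * Real.cos a.dec) • a.eAlpha + a.decRate • a.eDelta

/-! The coefficients in `c = D ρ' + E ρ² + F ρ + G`. -/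

/-- `D = q × e^ρ`. -/
def vD : Fin 3 → ℝ := a.obsPos ⨯₃ a.eRho
/-- `E = e^ρ × η`. -/
def vE : Fin 3 → ℝ := a.eRho ⨯₃ a.eta
/-- `F = q × η + e^ρ × q'`. -/
def vF : Fin 3 → ℝ := a.obsPos ⨯₃ a.eta + a.eRho ⨯₃ a.obsVel
/-- `G = q × q'`. -/
def vG : Fin 3 → ℝ := a.obsPos ⨯₃ a.obsVel

end EpochData

/-! ### The Keplerian integrals

The unknowns `ρ, ρ', u` are taken in an arbitrary commutative `ℝ`-algebra `R`, so that the same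
formulas apply in each of the polynomial rings used below. -/

section Kepler

variable {R : Type} [CommRing R] [Algebra ℝ R]

/-- A real vector, seen as a vector over `R`. -/
def emb (R : Type) [CommRing R] [Algebra ℝ R] (v : Fin 3 → ℝ) : Fin 3 → R :=
  fun i => algebraMap ℝ R (v i)

/-- Heliocentric position `r = ρ e^ρ + q`. -/
def pos (a : EpochData) (ρ : R) : Fin 3 → R :=
  ρ • emb R a.eRho + emb R a.obsPos

/-- Heliocentric velocity `r' = ρ' e^ρ + ρ η + q'`. -/
def vel (a : EpochData) (ρ ρ' : R) : Fin 3 → R :=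
  ρ' • emb R a.eRho + ρ • emb R a.eta + emb R a.obsVel

/-- Angular momentum `c = r × r'`. -/
def angMom (a : EpochData) (ρ ρ' : R) : Fin 3 → R :=
  pos a ρ ⨯₃ vel a ρ ρ'

/-- The vector `μL = (|r'|² - u) r - (r · r') r'`, where `u` stands for `μ/|r|`. -/
def lenz (a : EpochData) (ρ ρ' u : R) : Fin 3 → R :=
  (vel a ρ ρ' ⬝ᵥ vel a ρ ρ' - u) • pos a ρ - (pos a ρ ⬝ᵥ vel a ρ ρ') • vel a ρ ρ'

/-- Energy `ℰ = |r'|²/2 - u`, where `u` stands for `μ/|r|`. -/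
def energy (a : EpochData) (ρ ρ' u : R) : R :=
  (1 / 2 : ℝ) • (vel a ρ ρ' ⬝ᵥ vel a ρ ρ') - u

/-- `ξ = [(μL₁ - μL₂) - (ℰ₁ r₁ - ℰ₂ r₂)] × (r₁ - r₂)`. -/
def xi (d : LinkData) (ρ₁ ρ₂ ρ₁' ρ₂' u₁ u₂ : R) : Fin 3 → R :=
  (lenz d.1 ρ₁ ρ₁' u₁ - lenz d.2 ρ₂ ρ₂' u₂ -
    (energy d.1 ρ₁ ρ₁' u₁ • pos d.1 ρ₁ - energy d.2 ρ₂ ρ₂' u₂ • pos d.2 ρ₂)) ⨯₃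
    (pos d.1 ρ₁ - pos d.2 ρ₂)

/-- The quantities `u₁, u₂` cancel out in `ξ`. -/
theorem xi_eq_xi_zero (d : LinkData) (ρ₁ ρ₂ ρ₁' ρ₂' u₁ u₂ : R) :
    xi d ρ₁ ρ₂ ρ₁' ρ₂' u₁ u₂ = xi d ρ₁ ρ₂ ρ₁' ρ₂' 0 0 := by
  unfold xi
  congr 2
  simp only [lenz, energy, sub_smul, zero_smul]
  abel

/-- `J = E₂ρ₂² - E₁ρ₁² + F₂ρ₂ - F₁ρ₁ + G₂ - G₁`. -/
def vJ (d : LinkData) (ρ₁ ρ₂ : R) : Fin 3 → R :=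
  ρ₂ ^ 2 • emb R d.2.vE - ρ₁ ^ 2 • emb R d.1.vE + ρ₂ • emb R d.2.vF - ρ₁ • emb R d.1.vF +
    emb R d.2.vG - emb R d.1.vG

/-- `D₁ × D₂`. -/
def dCross (d : LinkData) : Fin 3 → ℝ := d.1.vD ⨯₃ d.2.vD

/-- `q = D₁ × D₂ · J`. -/
def qPoly (d : LinkData) (ρ₁ ρ₂ : R) : R := emb R (dCross d) ⬝ᵥ vJ d ρ₁ ρ₂

/-- The radial velocity at the first epoch,
`ρ₁' = (J × D₂) · (D₁ × D₂) / |D₁ × D₂|²`, as a function of `ρ₁, ρ₂`. -/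
def rhoDot₁ (d : LinkData) (ρ₁ ρ₂ : R) : R :=
  (dCross d ⬝ᵥ dCross d)⁻¹ • ((vJ d ρ₁ ρ₂ ⨯₃ emb R d.2.vD) ⬝ᵥ emb R (dCross d))

/-- The radial velocity at the second epoch,
`ρ₂' = (J × D₁) · (D₁ × D₂) / |D₁ × D₂|²`, as a function of `ρ₁, ρ₂`. -/
def rhoDot₂ (d : LinkData) (ρ₁ ρ₂ : R) : R :=
  (dCross d ⬝ᵥ dCross d)⁻¹ • ((vJ d ρ₁ ρ₂ ⨯₃ emb R d.1.vD) ⬝ᵥ emb R (dCross d))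

/-- `ξ` as a function of `ρ₁, ρ₂`, after substitution of the radial velocities; `u₁, u₂` are set
to `0`, which is harmless by `xi_eq_xi_zero`. -/
def xiElim (d : LinkData) (ρ₁ ρ₂ : R) : Fin 3 → R :=
  xi d ρ₁ ρ₂ (rhoDot₁ d ρ₁ ρ₂) (rhoDot₂ d ρ₁ ρ₂) 0 0

/-- `p₁ = ξ · e^ρ₁`. -/
def pPoly₁ (d : LinkData) (ρ₁ ρ₂ : R) : R := xiElim d ρ₁ ρ₂ ⬝ᵥ emb R d.1.eRho

/-- `p₂ = ξ · e^ρ₂`. -/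
def pPoly₂ (d : LinkData) (ρ₁ ρ₂ : R) : R := xiElim d ρ₁ ρ₂ ⬝ᵥ emb R d.2.eRho

end Kepler

/-! ### The univariate polynomial `𝔲`

Bivariate polynomials are elements of `ℝ[X][X]`: the outer variable is `ρ₁`, the inner one `ρ₂`. -/

/-- The variable `ρ₁` of `ℝ[ρ₂][ρ₁]`. -/
abbrev bρ₁ : ℝ[X][X] := Polynomial.X
/-- The variable `ρ₂` of `ℝ[ρ₂][ρ₁]`. -/
abbrev bρ₂ : ℝ[X][X] := Polynomial.C Polynomial.X

/-- `𝔲₁ = Res(p₁, q, ρ₁)`. -/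
def uRes₁ (d : LinkData) : ℝ[X] := Polynomial.resultant (pPoly₁ d bρ₁ bρ₂) (qPoly d bρ₁ bρ₂)

/-- `𝔲₂ = Res(p₂, q, ρ₁)`. -/
def uRes₂ (d : LinkData) : ℝ[X] := Polynomial.resultant (pPoly₂ d bρ₁ bρ₂) (qPoly d bρ₁ bρ₂)

/-- `𝔲 = gcd(𝔲₁, 𝔲₂)`, well defined up to a nonzero constant factor. -/
def uPoly (d : LinkData) : ℝ[X] := EuclideanDomain.gcd (uRes₁ d) (uRes₂ d)

/-! ### The ideal of the conservation laws -/

/-- The polynomial ring in the six variables `ρ₁', ρ₂', u₁, u₂, ρ₁, ρ₂`, listed in the decreasing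
order of the variables for the lexicographic order: in `MonomialOrder.lex` on `Fin 6` the variable
of index `0` is the largest one and the variable of index `5` is the smallest one. -/
abbrev Poly6 : Type := MvPolynomial (Fin 6) ℝ

/-- The variable `ρ₁'`. -/
abbrev xρ₁' : Poly6 := MvPolynomial.X 0
/-- The variable `ρ₂'`. -/
abbrev xρ₂' : Poly6 := MvPolynomial.X 1
/-- The variable `u₁`. -/
abbrev xu₁ : Poly6 := MvPolynomial.X 2
/-- The variable `u₂`. -/
abbrev xu₂ : Poly6 := MvPolynomial.X 3
/-- The variable `ρ₁`. -/
abbrev xρ₁ : Poly6 := MvPolynomial.X 4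
/-- The variable `ρ₂`. -/
abbrev xρ₂ : Poly6 := MvPolynomial.X 5

/-- The ideal `I` generated by the three components of `c₁ - c₂`, the three components of
`μL₁ - μL₂`, and `ℰ₁ - ℰ₂`. -/
def keplerIdeal (d : LinkData) : Ideal Poly6 :=
  Ideal.span
    (Set.range (angMom d.1 xρ₁ xρ₁' - angMom d.2 xρ₂ xρ₂') ∪
      Set.range (lenz d.1 xρ₁ xρ₁' xu₁ - lenz d.2 xρ₂ xρ₂' xu₂) ∪
      {energy d.1 xρ₁ xρ₁' xu₁ - energy d.2 xρ₂ xρ₂' xu₂})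

/-- `g₁, …, gₙ` is a Groebner basis of the ideal `I` for the monomial order `m`: the `gᵢ` belong to
`I`, and the leading term of every nonzero element of `I` is divisible by the leading term of
some `gᵢ`. -/
def IsGroebnerBasis {σ : Type} {n : ℕ} (m : MonomialOrder σ) (I : Ideal (MvPolynomial σ ℝ))
    (g : Fin n → MvPolynomial σ ℝ) : Prop :=
  (∀ i, g i ∈ I) ∧ ∀ f ∈ I, f ≠ 0 → ∃ i, m.leadingTerm (g i) ∣ m.leadingTerm f

end Linkage

end

/-! Write e₁, e₂ for the lines of sight, l_j = c_j · e_j, m₁ = D₂ · r₁ and m₂ = D₁ · r₂. Each l_j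
and m_j is an affine function of ρ_j alone (`mom`, `cof`).

If D₁ × D₂ ≠ 0, the law c₁ = c₂ amounts to q = 0 together with the formulas for the radial
velocities (`angMom_eq_iff`). Let w be the difference of the u-free parts of μL − ℰ r and let z = r₁
− r₂. The Lenz and energy laws then say w = −h z, with h the common energy. Since z · (e₁ × e₂) is a
nonzero constant, this holds as soon as ξ = w × z is orthogonal to e₁ and e₂, and h, hence u₁ and
u₂, is then determined (`lenz_energy_iff`). What remains is the planar system q = p₁ = p₂ = 0.

Now q = −(l₁ m₁ + l₂ m₂) (`qPoly_eq`), and on the conic q = 0 the vector ξ is parallel to the common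
angular momentum, so l₁ p₂ = l₂ p₁ there. The coordinate ring of the conic is free over ℝ[ρ₂] with
basis 1, ρ₁. Comparing coefficients gives p₁ = s m₂ + t l₁ and p₂ = t l₂ − s m₁ with s, t in ℝ[ρ₂]
(`NonDeg.conic_re_im`), both of degree at most 4. If s and t are coprime, a Bézout relation
expresses ρ₁ as a polynomial in ρ₂, and one equation in ρ₂ is left: a quadratic form in s, t with
coefficients of degree at most 1, hence of degree 9 unless its top coefficient vanishes
(`NonDeg.exists_planar_iff`). The resultants of p₁ and p₂ with q are norms from the conic; up to
constants they are m₂ and l₂ times this eliminant, so their gcd is the eliminant when l₂ and m₂ have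
no common root (`NonDeg.uPoly_associated`).

The ideal is therefore in shape position and its lexicographic basis can be written down
(`isGroebnerBasis_of_shape`). The equivalences are proved for values in an arbitrary commutative
ℝ-algebra, nilpotents allowed, so they determine the ideal itself and not merely its zero set.

Every condition used is the nonvanishing of a quotient of analytic functions of the data, so one
explicit data point satisfying all of them gives genericity (`genericAt_nonDeg`). -/

noncomputable section

namespace Linkage

/-! ### Vector identities over a commutative ring -/

section Vectors

variable {R S : Type} [CommRing R]

theorem dot_eq (x y : Fin 3 → R) : x ⬝ᵥ y = x 0 * y 0 + x 1 * y 1 + x 2 * y 2 := by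
  simp [dotProduct, Fin.sum_univ_three]

theorem cross_zero (x y : Fin 3 → R) : (x ⨯₃ y) 0 = x 1 * y 2 - x 2 * y 1 := by
  simp [cross_apply]

theorem cross_one (x y : Fin 3 → R) : (x ⨯₃ y) 1 = x 2 * y 0 - x 0 * y 2 := by
  simp [cross_apply]

theorem cross_two (x y : Fin 3 → R) : (x ⨯₃ y) 2 = x 0 * y 1 - x 1 * y 0 := by
  simp [cross_apply]

/-- A vector is determined by its products with `x`, `y`, `x × y` up to the factor `|x × y|²`. -/
theorem normSq_cross_mul_eq_zero {x y v : Fin 3 → R}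
    (h₁ : (v ⨯₃ y) ⬝ᵥ (x ⨯₃ y) = 0) (h₂ : (v ⨯₃ x) ⬝ᵥ (x ⨯₃ y) = 0)
    (h₃ : (x ⨯₃ y) ⬝ᵥ v = 0) (i : Fin 3) : ((x ⨯₃ y) ⬝ᵥ (x ⨯₃ y)) * v i = 0 := by
  simp only [dot_eq, cross_zero, cross_one, cross_two] at h₁ h₂ h₃ ⊢
  -- With N = x × y, the identity is |N|² v = ((v × y) · N) x − ((v × x) · N) y + (N · v) N, read in
  -- coordinates.
  fin_cases i <;> simp only [Fin.zero_eta, Fin.mk_one, Fin.reduceFinMk]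
  · linear_combination x 0 * h₁ - y 0 * h₂ + (x 1 * y 2 - x 2 * y 1) * h₃
  · linear_combination x 1 * h₁ - y 1 * h₂ + (x 2 * y 0 - x 0 * y 2) * h₃
  · linear_combination x 2 * h₁ - y 2 * h₂ + (x 0 * y 1 - x 1 * y 0) * h₃

/-- If `w × z` is orthogonal to `x` and `y`, then `w` and `z` have proportional products with
`x × y` and with every other vector. -/
theorem cross_dot_mul_eq {x y w z : Fin 3 → R}
    (hx : (w ⨯₃ z) ⬝ᵥ x = 0) (hy : (w ⨯₃ z) ⬝ᵥ y = 0) (i : Fin 3) :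
    (z ⬝ᵥ (x ⨯₃ y)) * w i = (w ⬝ᵥ (x ⨯₃ y)) * z i := by
  simp only [dot_eq, cross_zero, cross_one, cross_two] at hx hy ⊢
  fin_cases i <;> simp only [Fin.zero_eta, Fin.mk_one, Fin.reduceFinMk]
  · linear_combination y 0 * hx - x 0 * hy
  · linear_combination y 1 * hx - x 1 * hy
  · linear_combination y 2 * hx - x 2 * hy

/-- If `w` and `z` are orthogonal to `c`, then `w × z` is parallel to `c`. -/
theorem dot_mul_cross_dot_eq {c w z : Fin 3 → R} (hw : c ⬝ᵥ w = 0) (hz : c ⬝ᵥ z = 0)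
    (x y : Fin 3 → R) : (c ⬝ᵥ x) * ((w ⨯₃ z) ⬝ᵥ y) = (c ⬝ᵥ y) * ((w ⨯₃ z) ⬝ᵥ x) := by
  simp only [dot_eq, cross_zero, cross_one, cross_two] at hw hz ⊢
  linear_combination
    ((x 1 * y 2 - x 2 * y 1) * w 0 + (x 2 * y 0 - x 0 * y 2) * w 1
      + (x 0 * y 1 - x 1 * y 0) * w 2) * hz
    - ((x 1 * y 2 - x 2 * y 1) * z 0 + (x 2 * y 0 - x 0 * y 2) * z 1
      + (x 0 * y 1 - x 1 * y 0) * z 2) * hw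

variable [CommRing S] [Algebra ℝ R] [Algebra ℝ S]

theorem emb_cross (x y : Fin 3 → ℝ) : emb R (x ⨯₃ y) = emb R x ⨯₃ emb R y := by
  ext i
  fin_cases i <;> simp [emb, cross_apply]

theorem emb_add (x y : Fin 3 → ℝ) : emb R (x + y) = emb R x + emb R y := by
  ext i
  simp [emb]

theorem emb_sub (x y : Fin 3 → ℝ) : emb R (x - y) = emb R x - emb R y := by
  ext i
  simp [emb]

theorem algebraMap_dot (x y : Fin 3 → ℝ) :
    algebraMap ℝ R (x ⬝ᵥ y) = emb R x ⬝ᵥ emb R y := by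
  simp [emb, dot_eq]

/-! ### Compatibility of the Keplerian formulas with algebra homomorphisms -/

section Map

variable (φ : R →ₐ[ℝ] S)

theorem map_emb (v : Fin 3 → ℝ) (i : Fin 3) : φ (emb R v i) = emb S v i := by
  simp [emb]

theorem map_dot {x y : Fin 3 → R} {x' y' : Fin 3 → S} (hx : ∀ i, φ (x i) = x' i)
    (hy : ∀ i, φ (y i) = y' i) : φ (x ⬝ᵥ y) = x' ⬝ᵥ y' := by
  simp [dot_eq, hx, hy]

theorem map_cross {x y : Fin 3 → R} {x' y' : Fin 3 → S} (hx : ∀ i, φ (x i) = x' i)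
    (hy : ∀ i, φ (y i) = y' i) (i : Fin 3) : φ ((x ⨯₃ y) i) = (x' ⨯₃ y') i := by
  fin_cases i <;> simp [cross_zero, cross_one, cross_two, hx, hy]

theorem map_pos (a : EpochData) (ρ : R) (i : Fin 3) : φ (pos a ρ i) = pos a (φ ρ) i := by
  simp [pos, map_emb]

theorem map_vel (a : EpochData) (ρ ρ' : R) (i : Fin 3) :
    φ (vel a ρ ρ' i) = vel a (φ ρ) (φ ρ') i := by
  simp [vel, map_emb]

theorem map_angMom (a : EpochData) (ρ ρ' : R) (i : Fin 3) :
    φ (angMom a ρ ρ' i) = angMom a (φ ρ) (φ ρ') i :=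
  map_cross φ (map_pos φ a ρ) (map_vel φ a ρ ρ') i

theorem map_lenz (a : EpochData) (ρ ρ' u : R) (i : Fin 3) :
    φ (lenz a ρ ρ' u i) = lenz a (φ ρ) (φ ρ') (φ u) i := by
  simp [lenz, map_pos, map_vel, map_dot φ (map_vel φ a ρ ρ') (map_vel φ a ρ ρ'),
    map_dot φ (map_pos φ a ρ) (map_vel φ a ρ ρ')]

theorem map_energy (a : EpochData) (ρ ρ' u : R) :
    φ (energy a ρ ρ' u) = energy a (φ ρ) (φ ρ') (φ u) := by
  rw [energy, map_sub, map_smul, map_dot φ (map_vel φ a ρ ρ') (map_vel φ a ρ ρ'), energy]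

theorem map_xi (d : LinkData) (ρ₁ ρ₂ ρ₁' ρ₂' u₁ u₂ : R) (i : Fin 3) :
    φ (xi d ρ₁ ρ₂ ρ₁' ρ₂' u₁ u₂ i) =
      xi d (φ ρ₁) (φ ρ₂) (φ ρ₁') (φ ρ₂') (φ u₁) (φ u₂) i := by
  refine map_cross φ (fun j => ?_) (fun j => ?_) i <;>
    simp [map_pos, map_lenz, map_energy]

theorem map_vJ (d : LinkData) (ρ₁ ρ₂ : R) (i : Fin 3) :
    φ (vJ d ρ₁ ρ₂ i) = vJ d (φ ρ₁) (φ ρ₂) i := by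
  simp [vJ, map_emb]

theorem map_rhoDot₁ (d : LinkData) (ρ₁ ρ₂ : R) :
    φ (rhoDot₁ d ρ₁ ρ₂) = rhoDot₁ d (φ ρ₁) (φ ρ₂) := by
  rw [rhoDot₁, map_smul, map_dot φ (map_cross φ (map_vJ φ d ρ₁ ρ₂) (map_emb φ _)) (map_emb φ _),
    rhoDot₁]

theorem map_rhoDot₂ (d : LinkData) (ρ₁ ρ₂ : R) :
    φ (rhoDot₂ d ρ₁ ρ₂) = rhoDot₂ d (φ ρ₁) (φ ρ₂) := by
  rw [rhoDot₂, map_smul, map_dot φ (map_cross φ (map_vJ φ d ρ₁ ρ₂) (map_emb φ _)) (map_emb φ _),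
    rhoDot₂]

theorem map_xiElim (d : LinkData) (ρ₁ ρ₂ : R) (i : Fin 3) :
    φ (xiElim d ρ₁ ρ₂ i) = xiElim d (φ ρ₁) (φ ρ₂) i := by
  simp [xiElim, map_xi, map_rhoDot₁, map_rhoDot₂]

theorem map_pPoly₁ (d : LinkData) (ρ₁ ρ₂ : R) :
    φ (pPoly₁ d ρ₁ ρ₂) = pPoly₁ d (φ ρ₁) (φ ρ₂) :=
  map_dot φ (map_xiElim φ d ρ₁ ρ₂) (map_emb φ _)

theorem map_pPoly₂ (d : LinkData) (ρ₁ ρ₂ : R) :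
    φ (pPoly₂ d ρ₁ ρ₂) = pPoly₂ d (φ ρ₁) (φ ρ₂) :=
  map_dot φ (map_xiElim φ d ρ₁ ρ₂) (map_emb φ _)

end Map

/-! ### Elimination of the radial velocities and of the `u`-variables -/

theorem angMom_eq (a : EpochData) (ρ ρ' : R) :
    angMom a ρ ρ' = ρ' • emb R a.vD + ρ ^ 2 • emb R a.vE + ρ • emb R a.vF + emb R a.vG := by
  simp only [angMom, pos, vel, EpochData.vD, EpochData.vE, EpochData.vF, EpochData.vG, emb_cross,
    emb_add]
  ext i
  fin_cases i <;>
    simp only [Fin.zero_eta, Fin.mk_one, Fin.reduceFinMk, cross_zero, cross_one, cross_two,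
      Pi.add_apply, Pi.smul_apply, smul_eq_mul] <;> ring

theorem angMom_sub_angMom (d : LinkData) (ρ₁ ρ₂ ρ₁' ρ₂' : R) :
    angMom d.1 ρ₁ ρ₁' - angMom d.2 ρ₂ ρ₂' =
      ρ₁' • emb R d.1.vD - ρ₂' • emb R d.2.vD - vJ d ρ₁ ρ₂ := by
  rw [angMom_eq, angMom_eq, vJ]
  abel

theorem algebraMap_inv_mul {c : ℝ} (hc : c ≠ 0) :
    algebraMap ℝ R c⁻¹ * algebraMap ℝ R c = 1 := by
  rw [← map_mul, inv_mul_cancel₀ hc, map_one]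

/-- The law reads ρ₁' D₁ − ρ₂' D₂ = J. Its component along D₁ × D₂ is q = 0, and its two components
in the plane of D₁, D₂ are solved for ρ₁', ρ₂' by Cramer's rule; `normSq_cross_mul_eq_zero` says
that these three components suffice. -/
theorem angMom_eq_iff {d : LinkData} (hd : dCross d ⬝ᵥ dCross d ≠ 0) (ρ₁ ρ₂ ρ₁' ρ₂' : R) :
    angMom d.1 ρ₁ ρ₁' = angMom d.2 ρ₂ ρ₂' ↔
      qPoly d ρ₁ ρ₂ = 0 ∧ ρ₁' = rhoDot₁ d ρ₁ ρ₂ ∧ ρ₂' = rhoDot₂ d ρ₁ ρ₂ := by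
  have hinv := algebraMap_inv_mul (R := R) hd
  rw [← sub_eq_zero, angMom_sub_angMom, rhoDot₁, rhoDot₂, qPoly,
    Algebra.smul_def (dCross d ⬝ᵥ dCross d)⁻¹, Algebra.smul_def (dCross d ⬝ᵥ dCross d)⁻¹]
  rw [algebraMap_dot] at hinv
  generalize algebraMap ℝ R (dCross d ⬝ᵥ dCross d)⁻¹ = k at *
  simp only [dCross, emb_cross] at *
  generalize emb R d.1.vD = x at *
  generalize emb R d.2.vD = y at *
  generalize vJ d ρ₁ ρ₂ = J
  constructor
  · intro h
    have hJ : J = ρ₁' • x - ρ₂' • y := (sub_eq_zero.mp h).symm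
    subst hJ
    simp only [dot_eq, cross_zero, cross_one, cross_two, Pi.sub_apply, Pi.smul_apply,
      smul_eq_mul] at hinv ⊢
    refine ⟨by ring, ?_, ?_⟩
    · linear_combination -ρ₁' * hinv
    · linear_combination -ρ₂' * hinv
  · rintro ⟨h, h₁, h₂⟩
    have h₃ : (x ⨯₃ y) ⬝ᵥ (ρ₁' • x - ρ₂' • y - J) = 0 := by
      simp only [dot_eq, cross_zero, cross_one, cross_two, Pi.sub_apply, Pi.smul_apply,
        smul_eq_mul] at h ⊢
      linear_combination -h
    have h₄ : ((ρ₁' • x - ρ₂' • y - J) ⨯₃ y) ⬝ᵥ (x ⨯₃ y) = 0 := by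
      simp only [dot_eq, cross_zero, cross_one, cross_two, Pi.sub_apply, Pi.smul_apply,
        smul_eq_mul] at hinv h₁ ⊢
      generalize hN : (x 1 * y 2 - x 2 * y 1) * (x 1 * y 2 - x 2 * y 1) +
        (x 2 * y 0 - x 0 * y 2) * (x 2 * y 0 - x 0 * y 2) +
        (x 0 * y 1 - x 1 * y 0) * (x 0 * y 1 - x 1 * y 0) = N at *
      linear_combination N * h₁ - ρ₁' * hN + ((J 1 * y 2 - J 2 * y 1) * (x 1 * y 2 - x 2 * y 1) +
        (J 2 * y 0 - J 0 * y 2) * (x 2 * y 0 - x 0 * y 2) +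
        (J 0 * y 1 - J 1 * y 0) * (x 0 * y 1 - x 1 * y 0)) * hinv + 2 * ρ₁' * hN
    have h₅ : ((ρ₁' • x - ρ₂' • y - J) ⨯₃ x) ⬝ᵥ (x ⨯₃ y) = 0 := by
      simp only [dot_eq, cross_zero, cross_one, cross_two, Pi.sub_apply, Pi.smul_apply,
        smul_eq_mul] at hinv h₂ ⊢
      generalize hN : (x 1 * y 2 - x 2 * y 1) * (x 1 * y 2 - x 2 * y 1) +
        (x 2 * y 0 - x 0 * y 2) * (x 2 * y 0 - x 0 * y 2) +
        (x 0 * y 1 - x 1 * y 0) * (x 0 * y 1 - x 1 * y 0) = N at *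
      linear_combination N * h₂ + ρ₂' * hN + ((J 1 * x 2 - J 2 * x 1) * (x 1 * y 2 - x 2 * y 1) +
        (J 2 * x 0 - J 0 * x 2) * (x 2 * y 0 - x 0 * y 2) +
        (J 0 * x 1 - J 1 * x 0) * (x 0 * y 1 - x 1 * y 0)) * hinv
    ext i
    have := normSq_cross_mul_eq_zero h₄ h₅ h₃ i
    rw [Pi.zero_apply]
    linear_combination k * this - (ρ₁' • x - ρ₂' • y - J) i * hinv

/-- `|r'|² r / 2 - (r · r') r'`, the part of `μL - ℰ r` that does not involve `u`. -/
def redLenz (a : EpochData) (ρ ρ' : R) : Fin 3 → R :=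
  ((1 / 2 : ℝ) • (vel a ρ ρ' ⬝ᵥ vel a ρ ρ')) • pos a ρ - (pos a ρ ⬝ᵥ vel a ρ ρ') • vel a ρ ρ'

theorem lenz_eq (a : EpochData) (ρ ρ' u : R) :
    lenz a ρ ρ' u = redLenz a ρ ρ' + energy a ρ ρ' u • pos a ρ := by
  have h : vel a ρ ρ' ⬝ᵥ vel a ρ ρ' - u =
      (1 / 2 : ℝ) • (vel a ρ ρ' ⬝ᵥ vel a ρ ρ') + energy a ρ ρ' u := by
    rw [energy, ← add_sub_assoc, ← add_smul]
    norm_num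
  rw [lenz, h, redLenz, add_smul]
  abel

theorem xi_eq (d : LinkData) (ρ₁ ρ₂ ρ₁' ρ₂' u₁ u₂ : R) :
    xi d ρ₁ ρ₂ ρ₁' ρ₂' u₁ u₂ =
      (redLenz d.1 ρ₁ ρ₁' - redLenz d.2 ρ₂ ρ₂') ⨯₃ (pos d.1 ρ₁ - pos d.2 ρ₂) := by
  rw [xi, lenz_eq, lenz_eq]
  congr 2
  abel

/-- `(q₁ - q₂) · (e₁ × e₂)`. -/
def baseVolume (d : LinkData) : ℝ :=
  (d.1.obsPos - d.2.obsPos) ⬝ᵥ (d.1.eRho ⨯₃ d.2.eRho)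

/-- The terms of r₁ − r₂ that involve ρ₁, ρ₂ lie in the plane of the two lines of sight. -/
theorem pos_sub_pos_dot (d : LinkData) (ρ₁ ρ₂ : R) :
    (pos d.1 ρ₁ - pos d.2 ρ₂) ⬝ᵥ (emb R d.1.eRho ⨯₃ emb R d.2.eRho) =
      algebraMap ℝ R (baseVolume d) := by
  rw [baseVolume, algebraMap_dot, emb_cross, emb_sub]
  simp only [pos, dot_eq, cross_zero, cross_one, cross_two, Pi.sub_apply, Pi.add_apply,
    Pi.smul_apply, smul_eq_mul]
  ring

/-- The common energy of the two orbits, as a function of `ρ₁, ρ₂, ρ₁', ρ₂'`. -/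
def commonEnergy (d : LinkData) (ρ₁ ρ₂ ρ₁' ρ₂' : R) : R :=
  -((baseVolume d)⁻¹ • ((redLenz d.1 ρ₁ ρ₁' - redLenz d.2 ρ₂ ρ₂') ⬝ᵥ
    (emb R d.1.eRho ⨯₃ emb R d.2.eRho)))

theorem map_redLenz (φ : R →ₐ[ℝ] S) (a : EpochData) (ρ ρ' : R) (i : Fin 3) :
    φ (redLenz a ρ ρ' i) = redLenz a (φ ρ) (φ ρ') i := by
  simp [redLenz, map_pos, map_vel, map_dot φ (map_vel φ a ρ ρ') (map_vel φ a ρ ρ'),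
    map_dot φ (map_pos φ a ρ) (map_vel φ a ρ ρ')]

theorem map_commonEnergy (φ : R →ₐ[ℝ] S) (d : LinkData) (ρ₁ ρ₂ ρ₁' ρ₂' : R) :
    φ (commonEnergy d ρ₁ ρ₂ ρ₁' ρ₂') = commonEnergy d (φ ρ₁) (φ ρ₂) (φ ρ₁') (φ ρ₂') := by
  have h : ∀ i, φ ((redLenz d.1 ρ₁ ρ₁' - redLenz d.2 ρ₂ ρ₂') i) =
      (redLenz d.1 (φ ρ₁) (φ ρ₁') - redLenz d.2 (φ ρ₂) (φ ρ₂')) i := fun i => by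
    simp [map_redLenz]
  rw [commonEnergy, map_neg, map_smul, map_dot φ h (map_cross φ (map_emb φ _) (map_emb φ _)),
    commonEnergy]

/-- With w the difference of the vectors `redLenz` and z = r₁ − r₂, the left side says that w = −h z
for the common energy h. Orthogonality of w × z to both lines of sight forces κ w to be a multiple
of z, where κ = z · (e₁ × e₂) is invertible, and pairing with e₁ × e₂ gives the value of h. -/
theorem lenz_energy_iff {d : LinkData} (hd : baseVolume d ≠ 0) (ρ₁ ρ₂ ρ₁' ρ₂' u₁ u₂ : R) :
    (lenz d.1 ρ₁ ρ₁' u₁ = lenz d.2 ρ₂ ρ₂' u₂ ∧ energy d.1 ρ₁ ρ₁' u₁ = energy d.2 ρ₂ ρ₂' u₂) ↔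
      xi d ρ₁ ρ₂ ρ₁' ρ₂' 0 0 ⬝ᵥ emb R d.1.eRho = 0 ∧
      xi d ρ₁ ρ₂ ρ₁' ρ₂' 0 0 ⬝ᵥ emb R d.2.eRho = 0 ∧
      energy d.1 ρ₁ ρ₁' u₁ = commonEnergy d ρ₁ ρ₂ ρ₁' ρ₂' ∧
      energy d.2 ρ₂ ρ₂' u₂ = commonEnergy d ρ₁ ρ₂ ρ₁' ρ₂' := by
  have hinv := algebraMap_inv_mul (R := R) hd
  have hz := pos_sub_pos_dot d ρ₁ ρ₂
  rw [lenz_eq, lenz_eq, xi_eq, commonEnergy, Algebra.smul_def (baseVolume d)⁻¹]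
  generalize energy d.1 ρ₁ ρ₁' u₁ = h₁
  generalize energy d.2 ρ₂ ρ₂' u₂ = h₂
  generalize emb R d.1.eRho = x at *
  generalize emb R d.2.eRho = y at *
  generalize algebraMap ℝ R (baseVolume d)⁻¹ = k at *
  generalize algebraMap ℝ R (baseVolume d) = κ at *
  have hrw : (redLenz d.1 ρ₁ ρ₁' + h₁ • pos d.1 ρ₁ = redLenz d.2 ρ₂ ρ₂' + h₂ • pos d.2 ρ₂ ∧
      h₁ = h₂) ↔ ((redLenz d.1 ρ₁ ρ₁' - redLenz d.2 ρ₂ ρ₂' =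
        -(h₁ • (pos d.1 ρ₁ - pos d.2 ρ₂))) ∧ h₁ = h₂) := by
    refine and_congr_left fun h => ?_
    subst h
    rw [← sub_eq_zero, ← sub_eq_zero (b := -_), smul_sub]
    exact iff_of_eq (congrArg (· = 0) (by abel))
  rw [hrw]
  generalize redLenz d.1 ρ₁ ρ₁' - redLenz d.2 ρ₂ ρ₂' = w at *
  generalize pos d.1 ρ₁ - pos d.2 ρ₂ = z at *
  constructor
  · rintro ⟨rfl, rfl⟩
    have he : h₁ = -(k * (-(h₁ • z) ⬝ᵥ (x ⨯₃ y))) := by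
      rw [neg_dotProduct, smul_dotProduct, hz, smul_eq_mul]
      linear_combination -h₁ * hinv
    refine ⟨?_, ?_, he, he⟩ <;>
      simp only [dot_eq, cross_zero, cross_one, cross_two, Pi.neg_apply, Pi.smul_apply,
        smul_eq_mul] <;> ring
  · rintro ⟨hx, hy, rfl, rfl⟩
    refine ⟨?_, rfl⟩
    ext i
    have := cross_dot_mul_eq hx hy i
    rw [hz] at this
    simp only [Pi.neg_apply, Pi.smul_apply, smul_eq_mul]
    linear_combination k * this - w i * hinv

/-! ### The planar system `q = p₁ = p₂ = 0` -/

/-- The coefficient of `ρ` in `c · e^ρ`. -/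
def momSlope (a : EpochData) : ℝ := (a.obsPos ⨯₃ a.eta) ⬝ᵥ a.eRho

/-- The constant term of `c · e^ρ`. -/
def momConst (a : EpochData) : ℝ := (a.obsPos ⨯₃ a.obsVel) ⬝ᵥ a.eRho

/-- `c · e^ρ`, as a function of `ρ`. -/
def mom (a : EpochData) (ρ : R) : R :=
  algebraMap ℝ R (momConst a) + algebraMap ℝ R (momSlope a) * ρ

/-- The coefficient of `ρ` in `D_b · r_a`. -/
def cofSlope (a b : EpochData) : ℝ := a.eRho ⬝ᵥ b.vD

/-- The constant term of `D_b · r_a`. -/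
def cofConst (a b : EpochData) : ℝ := a.obsPos ⬝ᵥ b.vD

/-- `D_b · r_a`, as a function of `ρ`. -/
def cof (a b : EpochData) (ρ : R) : R :=
  algebraMap ℝ R (cofConst a b) + algebraMap ℝ R (cofSlope a b) * ρ

theorem map_mom (φ : R →ₐ[ℝ] S) (a : EpochData) (ρ : R) : φ (mom a ρ) = mom a (φ ρ) := by
  simp [mom]

theorem map_cof (φ : R →ₐ[ℝ] S) (a b : EpochData) (ρ : R) :
    φ (cof a b ρ) = cof a b (φ ρ) := by
  simp [cof]

/-- In the triple product r × r' · e^ρ the components ρ e^ρ of r and ρ' e^ρ of r' drop out, which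
leaves an affine function of ρ. -/
theorem angMom_dot_eRho (a : EpochData) (ρ ρ' : R) : angMom a ρ ρ' ⬝ᵥ emb R a.eRho = mom a ρ := by
  simp only [mom, momConst, momSlope, algebraMap_dot, emb_cross]
  simp only [angMom, pos, vel, dot_eq, cross_zero, cross_one, cross_two, Pi.add_apply,
    Pi.smul_apply, smul_eq_mul]
  ring

/-- Since D₁ = r₁ × e₁, the vector D₁ × D₂ equals (r₁ · D₂) e₁ − (e₁ · D₂) r₁, and c₁ · r₁ = 0;
hence c₁ · (D₁ × D₂) = l₁ m₁. By symmetry c₂ · (D₁ × D₂) = −l₂ m₂. -/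
theorem qPoly_eq (d : LinkData) (ρ₁ ρ₂ : R) :
    qPoly d ρ₁ ρ₂ = -(mom d.1 ρ₁ * cof d.1 d.2 ρ₁ + mom d.2 ρ₂ * cof d.2 d.1 ρ₂) := by
  -- The radial velocities enter only through D₁ and D₂, which are orthogonal to D₁ × D₂, so they
  -- may be set to 0.
  have h : qPoly d ρ₁ ρ₂ = emb R (dCross d) ⬝ᵥ (angMom d.2 ρ₂ 0 - angMom d.1 ρ₁ 0) := by
    rw [← neg_sub, angMom_sub_angMom, qPoly]
    simp
  rw [h]
  simp only [mom, cof, momConst, momSlope, cofConst, cofSlope, dCross, algebraMap_dot, EpochData.vD, emb_cross]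
  simp only [angMom, pos, vel, dot_eq, cross_zero, cross_one, cross_two, Pi.add_apply,
    Pi.sub_apply, Pi.smul_apply, smul_eq_mul]
  ring

theorem angMom_dot_pos (a : EpochData) (ρ ρ' : R) : angMom a ρ ρ' ⬝ᵥ pos a ρ = 0 := by
  simp only [angMom, dot_eq, cross_zero, cross_one, cross_two]
  ring

theorem angMom_dot_redLenz (a : EpochData) (ρ ρ' : R) :
    angMom a ρ ρ' ⬝ᵥ redLenz a ρ ρ' = 0 := by
  have h : angMom a ρ ρ' ⬝ᵥ vel a ρ ρ' = 0 := by
    simp only [angMom, dot_eq, cross_zero, cross_one, cross_two]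
    ring
  rw [redLenz, dotProduct_sub, dotProduct_smul, dotProduct_smul, angMom_dot_pos, h]
  simp

/-- On the conic `q = 0` the vector `ξ` is parallel to the common angular momentum. -/
theorem mom_mul_pPoly {d : LinkData} (hd : dCross d ⬝ᵥ dCross d ≠ 0) {ρ₁ ρ₂ : R}
    (hq : qPoly d ρ₁ ρ₂ = 0) :
    mom d.1 ρ₁ * pPoly₂ d ρ₁ ρ₂ = mom d.2 ρ₂ * pPoly₁ d ρ₁ ρ₂ := by
  -- On the conic the substituted radial velocities make the two angular momenta equal, and this
  -- common vector is orthogonal to both factors of ξ.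
  have hc := (angMom_eq_iff hd ρ₁ ρ₂ _ _).mpr ⟨hq, rfl, rfl⟩
  rw [← angMom_dot_eRho d.1 ρ₁ (rhoDot₁ d ρ₁ ρ₂), ← angMom_dot_eRho d.2 ρ₂ (rhoDot₂ d ρ₁ ρ₂), ← hc,
    pPoly₁, pPoly₂, xiElim, xi_eq]
  apply dot_mul_cross_dot_eq
  · rw [dotProduct_sub, angMom_dot_redLenz, hc, angMom_dot_redLenz, sub_zero]
  · rw [dotProduct_sub, angMom_dot_pos, hc, angMom_dot_pos, sub_zero]

end Vectors

/-! ### The coordinate ring of the conic `q = 0` -/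

/-- The conic `q = 0` reads `ρ₁² = conicRe + conicIm ρ₁`. -/
def conicRe (d : LinkData) : ℝ[X] :=
  -(Polynomial.C (momSlope d.1 * cofSlope d.1 d.2)⁻¹ *
    (mom d.2 Polynomial.X * cof d.2 d.1 Polynomial.X +
      Polynomial.C (momConst d.1 * cofConst d.1 d.2)))

/-- The conic `q = 0` reads `ρ₁² = conicRe + conicIm ρ₁`. -/
def conicIm (d : LinkData) : ℝ[X] :=
  -Polynomial.C ((momSlope d.1 * cofSlope d.1 d.2)⁻¹ *
    (momSlope d.1 * cofConst d.1 d.2 + momConst d.1 * cofSlope d.1 d.2))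

/-- The coordinate ring of the conic `q = 0`, as a quadratic extension of `ℝ[ρ₂]`. -/
abbrev Conic (d : LinkData) : Type := QuadraticAlgebra ℝ[X] (conicRe d) (conicIm d)

/-- The function `ρ₁` on the conic. -/
def cρ₁ (d : LinkData) : Conic d := ⟨0, 1⟩

/-- The function `ρ₂` on the conic. -/
def cρ₂ (d : LinkData) : Conic d := ⟨Polynomial.X, 0⟩

variable {R : Type} [CommRing R] [Algebra ℝ R]

theorem algebraMap_conic (d : LinkData) (c : ℝ) :
    algebraMap ℝ (Conic d) c = ⟨Polynomial.C c, 0⟩ := rfl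

theorem sq_eq_of_qPoly_eq_zero {d : LinkData} (h₁ : momSlope d.1 ≠ 0)
    (h₂ : cofSlope d.1 d.2 ≠ 0) {ρ₁ ρ₂ : R} (hq : qPoly d ρ₁ ρ₂ = 0) :
    ρ₁ * ρ₁ = Polynomial.aeval ρ₂ (conicRe d) + Polynomial.aeval ρ₂ (conicIm d) * ρ₁ := by
  rw [qPoly_eq, neg_eq_zero] at hq
  have hinv := algebraMap_inv_mul (R := R) (mul_ne_zero h₁ h₂)
  have hm := map_mom (Polynomial.aeval (R := ℝ) ρ₂) d.2 Polynomial.X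
  have hc := map_cof (Polynomial.aeval (R := ℝ) ρ₂) d.2 d.1 Polynomial.X
  rw [Polynomial.aeval_X] at hm hc
  simp only [conicRe, conicIm, map_neg, map_mul, map_add, Polynomial.aeval_C, hm, hc] at hinv ⊢
  generalize algebraMap ℝ R (momSlope d.1 * cofSlope d.1 d.2)⁻¹ = k at *
  generalize mom d.2 ρ₂ * cof d.2 d.1 ρ₂ = n at *
  simp only [mom, cof] at hq
  linear_combination k * hq - ρ₁ * ρ₁ * hinv

/-- Evaluation of functions on the conic at a point. -/
def conicEval {d : LinkData} (h₁ : momSlope d.1 ≠ 0) (h₂ : cofSlope d.1 d.2 ≠ 0) {ρ₁ ρ₂ : R}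
    (hq : qPoly d ρ₁ ρ₂ = 0) : Conic d →ₐ[ℝ] R where
  toFun z := Polynomial.aeval ρ₂ z.re + Polynomial.aeval ρ₂ z.im * ρ₁
  map_one' := by
    simp [show (1 : Conic d).re = 1 from rfl, show (1 : Conic d).im = 0 from rfl]
  map_zero' := by simp
  map_add' x y := by
    simp only [QuadraticAlgebra.re_add, QuadraticAlgebra.im_add, map_add]
    ring
  map_mul' x y := by
    simp only [QuadraticAlgebra.re_mul, QuadraticAlgebra.im_mul, map_add, map_mul]
    linear_combination -(Polynomial.aeval ρ₂ x.im * Polynomial.aeval ρ₂ y.im) *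
      sq_eq_of_qPoly_eq_zero h₁ h₂ hq
  commutes' c := by simp [algebraMap_conic]

theorem conicEval_apply {d : LinkData} (h₁ : momSlope d.1 ≠ 0) (h₂ : cofSlope d.1 d.2 ≠ 0)
    {ρ₁ ρ₂ : R} (hq : qPoly d ρ₁ ρ₂ = 0) (z : Conic d) :
    conicEval h₁ h₂ hq z = Polynomial.aeval ρ₂ z.re + Polynomial.aeval ρ₂ z.im * ρ₁ := rfl

theorem mom_cρ₁ (d : LinkData) :
    mom d.1 (cρ₁ d) = ⟨Polynomial.C (momConst d.1), Polynomial.C (momSlope d.1)⟩ := by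
  ext1 <;> simp [mom, cρ₁, algebraMap_conic]

theorem cof_cρ₁ (d : LinkData) :
    cof d.1 d.2 (cρ₁ d) =
      ⟨Polynomial.C (cofConst d.1 d.2), Polynomial.C (cofSlope d.1 d.2)⟩ := by
  ext1 <;> simp [cof, cρ₁, algebraMap_conic]

theorem mom_cρ₂ (d : LinkData) : mom d.2 (cρ₂ d) = ⟨mom d.2 Polynomial.X, 0⟩ := by
  ext1 <;> simp [mom, cρ₂, algebraMap_conic]

theorem cof_cρ₂ (d : LinkData) : cof d.2 d.1 (cρ₂ d) = ⟨cof d.2 d.1 Polynomial.X, 0⟩ := by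
  ext1 <;> simp [cof, cρ₂, algebraMap_conic]

theorem C_inv_mul {c : ℝ} (hc : c ≠ 0) :
    (Polynomial.C c⁻¹ : ℝ[X]) * Polynomial.C c = 1 := by
  rw [← Polynomial.C_mul, inv_mul_cancel₀ hc, Polynomial.C_1]

theorem qPoly_conic {d : LinkData} (h₁ : momSlope d.1 ≠ 0) (h₂ : cofSlope d.1 d.2 ≠ 0) :
    qPoly d (cρ₁ d) (cρ₂ d) = 0 := by
  have hinv := C_inv_mul (mul_ne_zero h₁ h₂)
  rw [qPoly_eq, mom_cρ₁, cof_cρ₁, mom_cρ₂, cof_cρ₂, neg_eq_zero]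
  ext1
  · rw [QuadraticAlgebra.re_zero, QuadraticAlgebra.re_add, QuadraticAlgebra.re_mul,
      QuadraticAlgebra.re_mul]
    simp only [conicRe, Polynomial.C_mul] at hinv ⊢
    linear_combination -(mom d.2 Polynomial.X * cof d.2 d.1 Polynomial.X +
      Polynomial.C (momConst d.1) * Polynomial.C (cofConst d.1 d.2)) * hinv
  · rw [QuadraticAlgebra.im_zero, QuadraticAlgebra.im_add, QuadraticAlgebra.im_mul,
      QuadraticAlgebra.im_mul]
    simp only [conicIm, Polynomial.C_mul, Polynomial.C_add] at hinv ⊢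
    linear_combination
      -(Polynomial.C (momSlope d.1) * Polynomial.C (cofConst d.1 d.2) +
        Polynomial.C (momConst d.1) * Polynomial.C (cofSlope d.1 d.2)) * hinv

/-- The function `p₁` on the conic. -/
def cp₁ (d : LinkData) : Conic d := pPoly₁ d (cρ₁ d) (cρ₂ d)

/-- The function `p₂` on the conic. -/
def cp₂ (d : LinkData) : Conic d := pPoly₂ d (cρ₁ d) (cρ₂ d)

theorem cp₁_eq (d : LinkData) : cp₁ d = pPoly₁ d (cρ₁ d) (cρ₂ d) := rfl

theorem cp₂_eq (d : LinkData) : cp₂ d = pPoly₂ d (cρ₁ d) (cρ₂ d) := rfl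

attribute [irreducible] cp₁ cp₂

/-- The coefficient of `c₁ · e^ρ₁` in `p₁`, modulo `q`. -/
def tPoly (d : LinkData) : ℝ[X] := Polynomial.C (momSlope d.1)⁻¹ * (cp₁ d).im

/-- The coefficient of `D₁ · r₂` in `p₁`, modulo `q`. -/
def sPoly (d : LinkData) : ℝ[X] := -(Polynomial.C (cofSlope d.1 d.2)⁻¹ * (cp₂ d).im)

/-- The polynomial `𝔲`, up to a nonzero constant factor. -/
def elimPoly (d : LinkData) : ℝ[X] :=
  Polynomial.C (momSlope d.1) * mom d.2 Polynomial.X * tPoly d ^ 2 -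
    Polynomial.C (momSlope d.1 * cofConst d.1 d.2 - momConst d.1 * cofSlope d.1 d.2) *
      sPoly d * tPoly d +
    Polynomial.C (cofSlope d.1 d.2) * cof d.2 d.1 Polynomial.X * sPoly d ^ 2

/-- The nondegeneracy conditions on the data under which the elimination works. -/
structure NonDeg (d : LinkData) : Prop where
  dCross_ne : dCross d ⬝ᵥ dCross d ≠ 0
  baseVolume_ne : baseVolume d ≠ 0
  momSlope₁_ne : momSlope d.1 ≠ 0
  momSlope₂_ne : momSlope d.2 ≠ 0
  cofSlope₁_ne : cofSlope d.1 d.2 ≠ 0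
  det_ne : momConst d.2 * cofSlope d.2 d.1 - momSlope d.2 * cofConst d.2 d.1 ≠ 0
  coprime : IsCoprime (sPoly d) (tPoly d)
  lead_ne : momSlope d.1 * momSlope d.2 * (tPoly d).coeff 4 ^ 2 +
    cofSlope d.1 d.2 * cofSlope d.2 d.1 * (sPoly d).coeff 4 ^ 2 ≠ 0

theorem NonDeg.mom_ne_zero {d : LinkData} (hd : NonDeg d) : mom d.2 (Polynomial.X : ℝ[X]) ≠ 0 := by
  intro h
  have := congrArg (Polynomial.coeff · 1) h
  simp [mom, Polynomial.algebraMap_eq, hd.momSlope₂_ne, Polynomial.coeff_C] at this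

/-- This is p₁ = s m₂ + t l₁ and p₂ = t l₂ − s m₁ in the basis 1, ρ₁. The ρ₁-coefficients define t
and s. In l₁ p₂ = l₂ p₁ the ρ₁-coefficient then gives the constant term of p₂ after division by the
slope of l₁, and the constant term gives that of p₁ after cancellation of l₂. -/
theorem NonDeg.conic_re_im {d : LinkData} (hd : NonDeg d) :
    (cp₁ d).re = sPoly d * cof d.2 d.1 Polynomial.X + Polynomial.C (momConst d.1) * tPoly d ∧
    (cp₁ d).im = Polynomial.C (momSlope d.1) * tPoly d ∧
    (cp₂ d).re = mom d.2 Polynomial.X * tPoly d - Polynomial.C (cofConst d.1 d.2) * sPoly d ∧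
    (cp₂ d).im = -(Polynomial.C (cofSlope d.1 d.2) * sPoly d) := by
  have hβ := C_inv_mul hd.momSlope₁_ne
  have hδ := C_inv_mul hd.cofSlope₁_ne
  have hβδ := C_inv_mul (mul_ne_zero hd.momSlope₁_ne hd.cofSlope₁_ne)
  have hsyz : mom d.1 (cρ₁ d) * cp₂ d = mom d.2 (cρ₂ d) * cp₁ d := by
    rw [cp₁_eq, cp₂_eq]
    exact mom_mul_pPoly hd.dCross_ne (qPoly_conic hd.momSlope₁_ne hd.cofSlope₁_ne)
  have h₁ : (cp₁ d).im = Polynomial.C (momSlope d.1) * tPoly d := by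
    rw [tPoly]
    linear_combination -(cp₁ d).im * hβ
  have h₂ : (cp₂ d).im = -(Polynomial.C (cofSlope d.1 d.2) * sPoly d) := by
    rw [sPoly]
    linear_combination -(cp₂ d).im * hδ
  have hre := congrArg QuadraticAlgebra.re hsyz
  have him := congrArg QuadraticAlgebra.im hsyz
  simp only [mom_cρ₁, mom_cρ₂, QuadraticAlgebra.re_mul, QuadraticAlgebra.im_mul, h₁, h₂,
    Polynomial.C_mul] at hre him hβδ
  have hm := hd.mom_ne_zero
  generalize sPoly d = s at *
  generalize tPoly d = t at *
  generalize (cp₁ d).re = x at *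
  generalize (cp₂ d).re = y at *
  simp only [conicRe, conicIm, Polynomial.C_mul, Polynomial.C_add] at hre him
  generalize mom d.2 (Polynomial.X : ℝ[X]) = l at *
  generalize cof d.2 d.1 (Polynomial.X : ℝ[X]) = m at *
  generalize (Polynomial.C (momSlope d.1 * cofSlope d.1 d.2)⁻¹ : ℝ[X]) = k at *
  generalize (Polynomial.C (momSlope d.1)⁻¹ : ℝ[X]) = b' at *
  generalize (Polynomial.C (momSlope d.1) : ℝ[X]) = b at *
  generalize (Polynomial.C (cofSlope d.1 d.2) : ℝ[X]) = e at *
  generalize (Polynomial.C (momConst d.1) : ℝ[X]) = a at *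
  generalize (Polynomial.C (cofConst d.1 d.2) : ℝ[X]) = c at *
  have h₃ : y = l * t - c * s := by
    linear_combination b' * him + (l * t - c * s - y) * hβ - b' * s * (b * c + a * e) * hβδ
  refine ⟨mul_left_cancel₀ hm ?_, h₁, h₃, h₂⟩
  linear_combination -hre + a * h₃ + s * (l * m + a * c) * hβδ

/-- The values of `p₁` and `p₂` on the conic. -/
theorem NonDeg.pPoly_eq {d : LinkData} (hd : NonDeg d) {ρ₁ ρ₂ : R} (hq : qPoly d ρ₁ ρ₂ = 0) :
    pPoly₁ d ρ₁ ρ₂ = Polynomial.aeval ρ₂ (sPoly d) * cof d.2 d.1 ρ₂ +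
      Polynomial.aeval ρ₂ (tPoly d) * mom d.1 ρ₁ ∧
    pPoly₂ d ρ₁ ρ₂ = Polynomial.aeval ρ₂ (tPoly d) * mom d.2 ρ₂ -
      Polynomial.aeval ρ₂ (sPoly d) * cof d.1 d.2 ρ₁ := by
  obtain ⟨h₁, h₂, h₃, h₄⟩ := hd.conic_re_im
  set φ := conicEval hd.momSlope₁_ne hd.cofSlope₁_ne hq with hφ
  have hρ₁ : φ (cρ₁ d) = ρ₁ := by simp [hφ, conicEval_apply, cρ₁]
  have hρ₂ : φ (cρ₂ d) = ρ₂ := by simp [hφ, conicEval_apply, cρ₂]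
  have hm := map_mom (Polynomial.aeval (R := ℝ) ρ₂) d.2 Polynomial.X
  have hc := map_cof (Polynomial.aeval (R := ℝ) ρ₂) d.2 d.1 Polynomial.X
  rw [Polynomial.aeval_X] at hm hc
  constructor
  · have := map_pPoly₁ φ d (cρ₁ d) (cρ₂ d)
    rw [hρ₁, hρ₂] at this
    rw [← this, ← cp₁_eq, hφ, conicEval_apply, h₁, h₂]
    simp only [map_add, map_mul, Polynomial.aeval_C, hc, mom]
    ring
  · have := map_pPoly₂ φ d (cρ₁ d) (cρ₂ d)
    rw [hρ₁, hρ₂] at this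
    rw [← this, ← cp₂_eq, hφ, conicEval_apply, h₃, h₄]
    simp only [map_neg, map_sub, map_mul, Polynomial.aeval_C, hm, cof]
    ring

/-- The planar system is equivalent to a system in triangular form. -/
theorem NonDeg.exists_planar_iff {d : LinkData} (hd : NonDeg d) :
    ∃ f : ℝ[X], ∀ (R : Type) [CommRing R] [Algebra ℝ R] (ρ₁ ρ₂ : R),
      (qPoly d ρ₁ ρ₂ = 0 ∧ pPoly₁ d ρ₁ ρ₂ = 0 ∧ pPoly₂ d ρ₁ ρ₂ = 0) ↔
        Polynomial.aeval ρ₂ (elimPoly d) = 0 ∧ ρ₁ = Polynomial.aeval ρ₂ f := by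
  obtain ⟨σ, τ, hστ⟩ := hd.coprime
  -- With l₁ = α + β ρ₁ and m₁ = γ + δ ρ₁, the equations p₂ = 0 and p₁ = 0 read s ρ₁ = δ⁻¹ (t l₂ − γ
  -- s) and t ρ₁ = −β⁻¹ (s m₂ + α t). The relation σ s + τ t = 1 combines them into a formula for
  -- ρ₁.
  refine ⟨σ * Polynomial.C (cofSlope d.1 d.2)⁻¹ * (tPoly d * mom d.2 Polynomial.X -
      Polynomial.C (cofConst d.1 d.2) * sPoly d) -
    τ * Polynomial.C (momSlope d.1)⁻¹ * (sPoly d * cof d.2 d.1 Polynomial.X +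
      Polynomial.C (momConst d.1) * tPoly d), fun R _ _ ρ₁ ρ₂ => ?_⟩
  have hβ := algebraMap_inv_mul (R := R) hd.momSlope₁_ne
  have hδ := algebraMap_inv_mul (R := R) hd.cofSlope₁_ne
  have hm := map_mom (Polynomial.aeval (R := ℝ) ρ₂) d.2 Polynomial.X
  have hc := map_cof (Polynomial.aeval (R := ℝ) ρ₂) d.2 d.1 Polynomial.X
  rw [Polynomial.aeval_X] at hm hc
  have hst := congrArg (Polynomial.aeval ρ₂) hστ
  have hp := fun h => hd.pPoly_eq (ρ₁ := ρ₁) (ρ₂ := ρ₂) h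
  rw [qPoly_eq] at *
  simp only [elimPoly, map_add, map_sub, map_mul, map_pow, Polynomial.aeval_C, hm, hc,
    map_one] at hst ⊢
  have hl₁ : mom d.1 ρ₁ =
    algebraMap ℝ R (momConst d.1) + algebraMap ℝ R (momSlope d.1) * ρ₁ := rfl
  have hm₁ : cof d.1 d.2 ρ₁ =
    algebraMap ℝ R (cofConst d.1 d.2) + algebraMap ℝ R (cofSlope d.1 d.2) * ρ₁ := rfl
  generalize pPoly₁ d ρ₁ ρ₂ = p₁ at *
  generalize pPoly₂ d ρ₁ ρ₂ = p₂ at *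
  generalize Polynomial.aeval ρ₂ (sPoly d) = s at *
  generalize Polynomial.aeval ρ₂ (tPoly d) = t at *
  generalize Polynomial.aeval ρ₂ σ = σ at *
  generalize Polynomial.aeval ρ₂ τ = τ at *
  generalize mom d.2 ρ₂ = l₂ at *
  generalize cof d.2 d.1 ρ₂ = m₂ at *
  generalize mom d.1 ρ₁ = l₁ at *
  generalize cof d.1 d.2 ρ₁ = m₁ at *
  generalize algebraMap ℝ R (momSlope d.1)⁻¹ = β' at *
  generalize algebraMap ℝ R (momSlope d.1) = β at *
  generalize algebraMap ℝ R (cofSlope d.1 d.2)⁻¹ = δ' at *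
  generalize algebraMap ℝ R (cofSlope d.1 d.2) = δ at *
  generalize algebraMap ℝ R (momConst d.1) = α at *
  generalize algebraMap ℝ R (cofConst d.1 d.2) = γ at *
  constructor
  · rintro ⟨hq, h₁, h₂⟩
    obtain ⟨e₁, e₂⟩ := hp hq
    rw [h₁] at e₁
    rw [h₂] at e₂
    subst hl₁ hm₁
    constructor
    -- The eliminant is β t p₂ + δ s p₁, in which ρ₁ cancels.
    · linear_combination -β * t * e₂ - δ * s * e₁
    · linear_combination -ρ₁ * hst + σ * δ' * e₂ - τ * β' * e₁ - σ * s * ρ₁ * hδ -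
        τ * t * ρ₁ * hβ
  · rintro ⟨hu, hρ⟩
    have e₁ : s * m₂ + t * l₁ = 0 := by
      linear_combination t * hl₁ + β * t * hρ - τ * t * (s * m₂ + α * t) * hβ -
        (s * m₂ + t * α) * hst + σ * δ' * hu - σ * s * (s * m₂ + t * α) * hδ
    have e₂ : t * l₂ - s * m₁ = 0 := by
      linear_combination -s * hm₁ - s * δ * hρ - σ * s * (t * l₂ - γ * s) * hδ -
        (t * l₂ - s * γ) * hst + τ * β' * hu - τ * t * (t * l₂ - γ * s) * hβ
    -- The two equations give s (l₁ m₁ + l₂ m₂) = 0 and t (l₁ m₁ + l₂ m₂) = 0, so coprimality of s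
    -- and t recovers q = 0.
    have hq : -(l₁ * m₁ + l₂ * m₂) = 0 := by
      linear_combination (l₁ * m₁ + l₂ * m₂) * hst - σ * (l₂ * e₁ - l₁ * e₂) -
        τ * (m₁ * e₁ + m₂ * e₂)
    obtain ⟨e₃, e₄⟩ := hp hq
    exact ⟨hq, e₃.trans e₁, e₄.trans e₂⟩

/-! ### The degree of the eliminant -/

/-- Functions on the conic represented by polynomials of total degree at most `n`. -/
def ConicDeg {d : LinkData} (n : ℕ) (z : Conic d) : Prop :=
  z.re.natDegree ≤ n ∧ (Polynomial.X * z.im).natDegree ≤ n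

theorem natDegree_le_of_X_mul {p : ℝ[X]} {n : ℕ} (h : (Polynomial.X * p).natDegree ≤ n) :
    p.natDegree ≤ n := by
  rcases eq_or_ne p 0 with rfl | hp
  · simp
  · rw [Polynomial.natDegree_X_mul hp] at h
    omega

theorem natDegree_mom_X_le (a : EpochData) : (mom a (Polynomial.X : ℝ[X])).natDegree ≤ 1 := by
  rw [mom, Polynomial.algebraMap_eq]
  compute_degree

theorem natDegree_cof_X_le (a b : EpochData) :
    (cof a b (Polynomial.X : ℝ[X])).natDegree ≤ 1 := by
  rw [cof, Polynomial.algebraMap_eq]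
  compute_degree

theorem natDegree_conicRe_le (d : LinkData) : (conicRe d).natDegree ≤ 2 := by
  rw [conicRe, Polynomial.natDegree_neg]
  refine (Polynomial.natDegree_C_mul_le _ _).trans (Polynomial.natDegree_add_le_of_degree_le
    (Polynomial.natDegree_mul_le_of_le (natDegree_mom_X_le _) (natDegree_cof_X_le _ _)) ?_)
  rw [Polynomial.natDegree_C]
  exact Nat.zero_le 2

theorem natDegree_conicIm (d : LinkData) : (conicIm d).natDegree = 0 := by
  rw [conicIm, Polynomial.natDegree_neg, Polynomial.natDegree_C]

/-! ### The filtration by total degree on the conic -/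

namespace ConicDeg

variable {d : LinkData} {n m : ℕ} {z w : Conic d}

theorem const (c : ℝ) : ConicDeg n (algebraMap ℝ (Conic d) c) := by
  simp [ConicDeg, algebraMap_conic]

theorem add (hz : ConicDeg n z) (hw : ConicDeg n w) : ConicDeg n (z + w) := by
  refine ⟨Polynomial.natDegree_add_le_of_degree_le hz.1 hw.1, ?_⟩
  rw [QuadraticAlgebra.im_add, mul_add]
  exact Polynomial.natDegree_add_le_of_degree_le hz.2 hw.2

theorem neg (hz : ConicDeg n z) : ConicDeg n (-z) := by
  simpa [ConicDeg] using hz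

theorem sub (hz : ConicDeg n z) (hw : ConicDeg n w) : ConicDeg n (z - w) := by
  rw [sub_eq_add_neg]
  exact hz.add hw.neg

/-- Reduction by ρ₁² = `conicRe` + `conicIm` ρ₁ does not raise the total degree, because these
coefficients have degrees at most 2 and 0. The case of a zero ρ₁-coefficient is separate, since the
bound on `X * im` then carries no information about a degree. -/
theorem mul (hz : ConicDeg n z) (hw : ConicDeg m w) : ConicDeg (n + m) (z * w) := by
  constructor
  · rw [QuadraticAlgebra.re_mul]
    refine Polynomial.natDegree_add_le_of_degree_le
      (Polynomial.natDegree_mul_le_of_le hz.1 hw.1) ?_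
    rcases eq_or_ne z.im 0 with h | h
    · simp [h]
    rcases eq_or_ne w.im 0 with h' | h'
    · simp [h']
    have h₁ := hz.2
    have h₂ := hw.2
    rw [Polynomial.natDegree_X_mul h] at h₁
    rw [Polynomial.natDegree_X_mul h'] at h₂
    refine (Polynomial.natDegree_mul_le_of_le (Polynomial.natDegree_mul_le_of_le
      (natDegree_conicRe_le d) (Nat.le_sub_one_of_lt h₁))
      (Nat.le_sub_one_of_lt h₂)).trans ?_
    omega
  · have h : Polynomial.X * (z * w).im = z.re * (Polynomial.X * w.im) +
        (Polynomial.X * z.im) * w.re + conicIm d * ((Polynomial.X * z.im) * w.im) := by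
      rw [QuadraticAlgebra.im_mul]
      ring
    rw [h]
    refine Polynomial.natDegree_add_le_of_degree_le (Polynomial.natDegree_add_le_of_degree_le
      (Polynomial.natDegree_mul_le_of_le hz.1 hw.2)
      (Polynomial.natDegree_mul_le_of_le hz.2 hw.1)) ?_
    refine (Polynomial.natDegree_mul_le_of_le (natDegree_conicIm d).le
      (Polynomial.natDegree_mul_le_of_le hz.2 (natDegree_le_of_X_mul hw.2))).trans ?_
    omega

theorem smul (c : ℝ) (hz : ConicDeg n z) : ConicDeg n (c • z) := by
  rw [Algebra.smul_def]
  simpa using (const (n := 0) c).mul hz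

theorem dot {x y : Fin 3 → Conic d} (hx : ∀ i, ConicDeg n (x i)) (hy : ∀ i, ConicDeg m (y i)) :
    ConicDeg (n + m) (x ⬝ᵥ y) := by
  rw [dot_eq]
  exact (((hx 0).mul (hy 0)).add ((hx 1).mul (hy 1))).add ((hx 2).mul (hy 2))

theorem cross {x y : Fin 3 → Conic d} (hx : ∀ i, ConicDeg n (x i))
    (hy : ∀ i, ConicDeg m (y i)) (i : Fin 3) : ConicDeg (n + m) ((x ⨯₃ y) i) := by
  fin_cases i <;> simp only [Fin.zero_eta, Fin.mk_one, Fin.reduceFinMk]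
  · rw [cross_zero]
    exact ((hx 1).mul (hy 2)).sub ((hx 2).mul (hy 1))
  · rw [cross_one]
    exact ((hx 2).mul (hy 0)).sub ((hx 0).mul (hy 2))
  · rw [cross_two]
    exact ((hx 0).mul (hy 1)).sub ((hx 1).mul (hy 0))

theorem emb (v : Fin 3 → ℝ) (i : Fin 3) : ConicDeg n (emb (Conic d) v i) := const (v i)

theorem rho₁ : ConicDeg 1 (cρ₁ d) := by simp [ConicDeg, cρ₁]

theorem rho₂ : ConicDeg 1 (cρ₂ d) := by simp [ConicDeg, cρ₂]

theorem vJ (i : Fin 3) : ConicDeg 2 (vJ d (cρ₁ d) (cρ₂ d) i) := by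
  have h₁ : ConicDeg 2 (cρ₁ d ^ 2) := by
    rw [pow_two]
    exact rho₁.mul rho₁
  have h₂ : ConicDeg 2 (cρ₂ d ^ 2) := by
    rw [pow_two]
    exact rho₂.mul rho₂
  exact (((((h₂.mul (emb (n := 0) _ i)).sub (h₁.mul (emb (n := 0) _ i))).add
    (rho₂.mul (emb (n := 1) _ i))).sub (rho₁.mul (emb (n := 1) _ i))).add (emb _ i)).sub (emb _ i)

theorem rhoDot₁ : ConicDeg 2 (rhoDot₁ d (cρ₁ d) (cρ₂ d)) :=
  (dot (n := 2) (m := 0) (cross (m := 0) vJ (emb _)) (emb _)).smul _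

theorem rhoDot₂ : ConicDeg 2 (rhoDot₂ d (cρ₁ d) (cρ₂ d)) :=
  (dot (n := 2) (m := 0) (cross (m := 0) vJ (emb _)) (emb _)).smul _

theorem pos (a : EpochData) {ρ : Conic d} (hρ : ConicDeg 1 ρ) (i : Fin 3) :
    ConicDeg 1 (pos a ρ i) :=
  (hρ.mul (emb (n := 0) _ i)).add (emb _ i)

theorem vel (a : EpochData) {ρ ρ' : Conic d} (hρ : ConicDeg 1 ρ) (hρ' : ConicDeg 2 ρ')
    (i : Fin 3) : ConicDeg 2 (vel a ρ ρ' i) :=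
  ((hρ'.mul (emb (n := 0) _ i)).add (hρ.mul (emb (n := 1) _ i))).add (emb _ i)

/-- The plain count gives degree 6. When e^ρ · w is constant, r · w has degree 1 instead of 2 and r'
· w has degree 2 instead of 3, which saves one degree in both terms. -/
theorem redLenz_dot (a : EpochData) {ρ ρ' : Conic d} (hρ : ConicDeg 1 ρ) (hρ' : ConicDeg 2 ρ')
    {w : Fin 3 → Conic d} (hw : ∀ i, ConicDeg 1 (w i))
    (he : ConicDeg 0 (Linkage.emb (Conic d) a.eRho ⬝ᵥ w)) :
    ConicDeg 5 (redLenz a ρ ρ' ⬝ᵥ w) := by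
  have hr : ConicDeg 1 (Linkage.pos a ρ ⬝ᵥ w) := by
    rw [Linkage.pos, add_dotProduct, smul_dotProduct]
    exact (hρ.mul he).add (dot (n := 0) (emb _) hw)
  have hv : ConicDeg 2 (Linkage.vel a ρ ρ' ⬝ᵥ w) := by
    rw [Linkage.vel, add_dotProduct, add_dotProduct, smul_dotProduct, smul_dotProduct]
    exact ((hρ'.mul he).add (hρ.mul (dot (n := 0) (emb _) hw))).add (dot (n := 1) (emb _) hw)
  rw [redLenz, sub_dotProduct, smul_dotProduct, smul_dotProduct]
  exact (((dot (vel a hρ hρ') (vel a hρ hρ')).smul _).mul hr).sub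
    ((dot (pos a hρ) (vel a hρ hρ')).mul hv)

theorem cross_dot (x y z : Fin 3 → Conic d) : (x ⨯₃ y) ⬝ᵥ z = x ⬝ᵥ (y ⨯₃ z) := by
  simp only [dot_eq, cross_zero, cross_one, cross_two]
  ring

/-- The triple product moves e^ρ next to z = r₁ − r₂, so that `redLenz_dot` applies with w = z ×
e^ρ. The hypotheses hold because e₁ · w and e₂ · w are zero or plus or minus the constant z · (e₁ ×
e₂). -/
theorem xiElim_dot (a : EpochData) (h₁ : ConicDeg 0 (Linkage.emb (Conic d) d.1.eRho ⬝ᵥ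
      ((Linkage.pos d.1 (cρ₁ d) - Linkage.pos d.2 (cρ₂ d)) ⨯₃ Linkage.emb (Conic d) a.eRho)))
    (h₂ : ConicDeg 0 (Linkage.emb (Conic d) d.2.eRho ⬝ᵥ
      ((Linkage.pos d.1 (cρ₁ d) - Linkage.pos d.2 (cρ₂ d)) ⨯₃ Linkage.emb (Conic d) a.eRho))) :
    ConicDeg 5 (xiElim d (cρ₁ d) (cρ₂ d) ⬝ᵥ Linkage.emb (Conic d) a.eRho) := by
  have hw := cross (m := 0) (fun i => (pos d.1 (rho₁ (d := d)) i).sub (pos d.2 rho₂ i))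
    (emb a.eRho)
  rw [xiElim, xi_eq, cross_dot, sub_dotProduct]
  exact (redLenz_dot d.1 rho₁ rhoDot₁ hw h₁).sub (redLenz_dot d.2 rho₂ rhoDot₂ hw h₂)

theorem dot_cross_self (x y : Fin 3 → Conic d) : x ⬝ᵥ (y ⨯₃ x) = 0 := by
  simp only [dot_eq, cross_zero, cross_one, cross_two]
  ring

theorem cp₁ : ConicDeg 5 (cp₁ d) := by
  rw [cp₁_eq]
  refine xiElim_dot d.1 ?_ ?_
  · rw [dot_cross_self]
    simpa using const (n := 0) (d := d) 0
  · have h : ∀ x y z : Fin 3 → Conic d, y ⬝ᵥ (z ⨯₃ x) = z ⬝ᵥ (x ⨯₃ y) := fun x y z => by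
      simp only [dot_eq, cross_zero, cross_one, cross_two]
      ring
    rw [h, pos_sub_pos_dot]
    exact const _

theorem cp₂ : ConicDeg 5 (cp₂ d) := by
  rw [cp₂_eq]
  refine xiElim_dot d.2 ?_ ?_
  · have h : ∀ x y z : Fin 3 → Conic d, x ⬝ᵥ (z ⨯₃ y) = -(z ⬝ᵥ (x ⨯₃ y)) := fun x y z => by
      simp only [dot_eq, cross_zero, cross_one, cross_two]
      ring
    rw [h, pos_sub_pos_dot]
    exact (const _).neg
  · rw [dot_cross_self]
    simpa using const (n := 0) (d := d) 0

theorem natDegree_im_le {z : Conic d} (hz : ConicDeg (n + 1) z) : z.im.natDegree ≤ n := by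
  rcases eq_or_ne z.im 0 with h | h
  · simp [h]
  · have := hz.2
    rw [Polynomial.natDegree_X_mul h] at this
    omega

end ConicDeg

theorem natDegree_tPoly_le (d : LinkData) : (tPoly d).natDegree ≤ 4 :=
  (Polynomial.natDegree_C_mul_le _ _).trans ConicDeg.cp₁.natDegree_im_le

theorem natDegree_sPoly_le (d : LinkData) : (sPoly d).natDegree ≤ 4 := by
  rw [sPoly, Polynomial.natDegree_neg]
  exact (Polynomial.natDegree_C_mul_le _ _).trans ConicDeg.cp₂.natDegree_im_le

theorem natDegree_elimPoly_le (d : LinkData) : (elimPoly d).natDegree ≤ 9 := by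
  have hs := natDegree_sPoly_le d
  have ht := natDegree_tPoly_le d
  refine Polynomial.natDegree_add_le_of_degree_le ?_ ?_
  · rw [sub_eq_add_neg]
    refine Polynomial.natDegree_add_le_of_degree_le ?_ ?_
    · exact Polynomial.natDegree_mul_le_of_le
        ((Polynomial.natDegree_C_mul_le _ _).trans (natDegree_mom_X_le _))
        (Polynomial.natDegree_pow_le_of_le 2 ht)
    · rw [Polynomial.natDegree_neg]
      refine (Polynomial.natDegree_mul_le_of_le
        ((Polynomial.natDegree_C_mul_le _ _).trans hs) ht).trans ?_
      norm_num
  · exact Polynomial.natDegree_mul_le_of_le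
      ((Polynomial.natDegree_C_mul_le _ _).trans (natDegree_cof_X_le _ _))
      (Polynomial.natDegree_pow_le_of_le 2 hs)

/-- The mixed term s t has a constant coefficient and so stops at degree 8; only the two squares,
with their affine factors, reach degree 9. -/
theorem coeff_elimPoly (d : LinkData) : (elimPoly d).coeff 9 =
    momSlope d.1 * momSlope d.2 * (tPoly d).coeff 4 ^ 2 +
      cofSlope d.1 d.2 * cofSlope d.2 d.1 * (sPoly d).coeff 4 ^ 2 := by
  have hs := natDegree_sPoly_le d
  have ht := natDegree_tPoly_le d
  have h₁ : (mom d.2 (Polynomial.X : ℝ[X])).coeff 1 = momSlope d.2 := by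
    simp [mom, Polynomial.algebraMap_eq, Polynomial.coeff_C]
  have h₂ : (cof d.2 d.1 (Polynomial.X : ℝ[X])).coeff 1 = cofSlope d.2 d.1 := by
    simp [cof, Polynomial.algebraMap_eq, Polynomial.coeff_C]
  have h₃ : (mom d.2 Polynomial.X * tPoly d ^ 2).coeff 9 =
      momSlope d.2 * (tPoly d).coeff 4 ^ 2 := by
    rw [Polynomial.coeff_mul_add_eq_of_natDegree_le (natDegree_mom_X_le d.2)
      (Polynomial.natDegree_pow_le_of_le 2 ht) (df := 1) (dg := 8), h₁]
    exact congrArg _ (Polynomial.coeff_pow_of_natDegree_le ht)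
  have h₄ : (cof d.2 d.1 Polynomial.X * sPoly d ^ 2).coeff 9 =
      cofSlope d.2 d.1 * (sPoly d).coeff 4 ^ 2 := by
    rw [Polynomial.coeff_mul_add_eq_of_natDegree_le (natDegree_cof_X_le d.2 d.1)
      (Polynomial.natDegree_pow_le_of_le 2 hs) (df := 1) (dg := 8), h₂]
    exact congrArg _ (Polynomial.coeff_pow_of_natDegree_le hs)
  have h₅ : (sPoly d * tPoly d).coeff 9 = 0 :=
    Polynomial.coeff_eq_zero_of_natDegree_lt
      ((Polynomial.natDegree_mul_le_of_le hs ht).trans_lt (by norm_num))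
  rw [elimPoly, mul_assoc, mul_assoc, mul_assoc, Polynomial.coeff_add, Polynomial.coeff_sub,
    Polynomial.coeff_C_mul, Polynomial.coeff_C_mul, Polynomial.coeff_C_mul, h₃, h₄, h₅]
  ring

theorem NonDeg.natDegree_elimPoly {d : LinkData} (hd : NonDeg d) : (elimPoly d).natDegree = 9 := by
  refine le_antisymm (natDegree_elimPoly_le d) (Polynomial.le_natDegree_of_ne_zero ?_)
  rw [coeff_elimPoly]
  exact hd.lead_ne

/-! ### Resultants with a quadratic polynomial -/

section Resultant

open Polynomial

variable {A : Type} [CommRing A] [IsDomain A]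

/-- The resultant with a quadratic polynomial is a norm, up to a power of the leading
coefficient. -/
theorem resultant_quadratic (f : A[X]) (a b : A) {c : A} (hc : c ≠ 0) :
    f.resultant (C c * (X ^ 2 - C b * X - C a)) =
      c ^ f.natDegree * QuadraticAlgebra.norm (aeval (⟨0, 1⟩ : QuadraticAlgebra A a b) f) := by
  rw [show (⟨0, 1⟩ : QuadraticAlgebra A a b) = QuadraticAlgebra.omega from rfl]
  generalize hw : (QuadraticAlgebra.omega : QuadraticAlgebra A a b) = w
  set φ : A →+* QuadraticAlgebra A a b := algebraMap A (QuadraticAlgebra A a b) with hφ'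
  have hφ : Function.Injective φ := QuadraticAlgebra.algebraMap_injective
  have hdeg : (C c * (X ^ 2 - C b * X - C a)).natDegree = 2 := by
    rw [natDegree_C_mul hc]
    compute_degree!
  -- Over the quadratic extension the quadratic splits with roots ω and its conjugate, so the
  -- resultant becomes a product of two conjugate values of f.
  have hmap : (X ^ 2 - C b * X - C a).map φ = (X - C w) * (X - C (star w)) := by
    have h₁ : φ b = w + star w := by
      rw [← hw]
      ext1 <;> simp [φ]
    have h₂ : φ a = -(w * star w) := by
      rw [← hw]
      ext1 <;> simp [φ]
    simp only [Polynomial.map_sub, Polynomial.map_pow, Polynomial.map_mul, map_X, map_C, h₁, h₂,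
      C_add, C_neg, C_mul]
    ring
  have hstar : (f.map φ).eval (star w) = star ((f.map φ).eval w) := by
    have h : ∀ r, star (φ r) = φ r := fun r => by
      ext1 <;> simp [φ]
    rw [eval_map, eval_map, eval₂_eq_sum, eval₂_eq_sum, Polynomial.sum, Polynomial.sum, star_sum]
    refine Finset.sum_congr rfl fun n _ => ?_
    rw [star_mul, star_pow, h, mul_comm]
  apply hφ
  rw [hdeg, ← resultant_map_map, Polynomial.map_mul, map_C, resultant_C_mul_right, hmap]
  have hX : ∀ v : QuadraticAlgebra A a b, (X - C v).natDegree = 1 := natDegree_X_sub_C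
  have := resultant_mul_right (f.map φ) (X - C w) (X - C (star w)) f.natDegree natDegree_map_le
  rw [hX, hX, resultant_X_sub_C_right _ _ _ natDegree_map_le,
    resultant_X_sub_C_right _ _ _ natDegree_map_le, hstar] at this
  rw [this, map_mul, map_pow, QuadraticAlgebra.algebraMap_norm_eq_mul_star, eval_map_algebraMap]
  have hsq : ((-1 : QuadraticAlgebra A a b) ^ f.natDegree) * (-1) ^ f.natDegree = 1 := by
    rw [← mul_pow]
    simp
  linear_combination (φ c ^ f.natDegree * (aeval w f * star (aeval w f))) * hsq

end Resultant

/-! ### The polynomial `𝔲` -/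

/-- Restriction of bivariate polynomials to the conic. -/
def toConic (d : LinkData) : ℝ[X][X] →ₐ[ℝ] Conic d :=
  (Polynomial.aeval (⟨0, 1⟩ : Conic d)).restrictScalars ℝ

theorem toConic_apply (d : LinkData) (f : ℝ[X][X]) :
    toConic d f = Polynomial.aeval (⟨0, 1⟩ : Conic d) f := rfl

theorem toConic_bρ₁ (d : LinkData) : toConic d bρ₁ = cρ₁ d := by
  simp [toConic_apply, cρ₁]

theorem toConic_bρ₂ (d : LinkData) : toConic d bρ₂ = cρ₂ d := by
  rw [toConic_apply, Polynomial.aeval_C]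
  rfl

theorem NonDeg.qPoly_bivariate {d : LinkData} (hd : NonDeg d) :
    qPoly d bρ₁ bρ₂ = Polynomial.C (Polynomial.C (-(momSlope d.1 * cofSlope d.1 d.2))) *
      (Polynomial.X ^ 2 - Polynomial.C (conicIm d) * Polynomial.X - Polynomial.C (conicRe d)) := by
  have hm := map_mom (Polynomial.CAlgHom (R := ℝ) (A := ℝ[X])) d.2 Polynomial.X
  have hc := map_cof (Polynomial.CAlgHom (R := ℝ) (A := ℝ[X])) d.2 d.1 Polynomial.X
  have hinv := congrArg (Polynomial.C (R := ℝ[X]))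
    (C_inv_mul (mul_ne_zero hd.momSlope₁_ne hd.cofSlope₁_ne))
  have hm₁ : mom d.1 bρ₁ = Polynomial.C (Polynomial.C (momConst d.1)) +
    Polynomial.C (Polynomial.C (momSlope d.1)) * Polynomial.X := rfl
  have hc₁ : cof d.1 d.2 bρ₁ = Polynomial.C (Polynomial.C (cofConst d.1 d.2)) +
    Polynomial.C (Polynomial.C (cofSlope d.1 d.2)) * Polynomial.X := rfl
  rw [Polynomial.CAlgHom_apply, Polynomial.CAlgHom_apply] at hm hc
  rw [qPoly_eq, ← hm, ← hc, hm₁, hc₁, conicRe, conicIm]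
  simp only [Polynomial.C_neg, Polynomial.C_mul, Polynomial.C_add,
    Polynomial.C_1] at hinv ⊢
  generalize (Polynomial.C (Polynomial.C (momSlope d.1 * cofSlope d.1 d.2)⁻¹) : ℝ[X][X]) = k at *
  generalize (Polynomial.C (mom d.2 (Polynomial.X : ℝ[X])) : ℝ[X][X]) = l at *
  generalize (Polynomial.C (cof d.2 d.1 (Polynomial.X : ℝ[X])) : ℝ[X][X]) = m at *
  generalize (Polynomial.C (Polynomial.C (momSlope d.1)) : ℝ[X][X]) = b at *
  generalize (Polynomial.C (Polynomial.C (cofSlope d.1 d.2)) : ℝ[X][X]) = e at *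
  generalize (Polynomial.C (Polynomial.C (momConst d.1)) : ℝ[X][X]) = a at *
  generalize (Polynomial.C (Polynomial.C (cofConst d.1 d.2)) : ℝ[X][X]) = c at *
  linear_combination (l * m + a * c + (b * c + a * e) * Polynomial.X) * hinv

theorem NonDeg.resultant_qPoly {d : LinkData} (hd : NonDeg d) (f : ℝ[X][X]) :
    f.resultant (qPoly d bρ₁ bρ₂) =
      Polynomial.C ((-(momSlope d.1 * cofSlope d.1 d.2)) ^ f.natDegree) *
        (toConic d f).norm := by
  rw [hd.qPoly_bivariate, resultant_quadratic, toConic_apply, Polynomial.C_pow]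
  rw [Ne, Polynomial.C_eq_zero, neg_eq_zero]
  exact mul_ne_zero hd.momSlope₁_ne hd.cofSlope₁_ne

/-- The norm of l₁ is a constant times l₂ m₂ and its trace is constant, so the norm of s m₂ + t l₁
is m₂ times a quadratic form in s and t. The case of p₂ is similar. The extra factor reflects the
points l₁ = m₂ = 0 of the conic, at which p₁ vanishes for trivial reasons. -/
theorem NonDeg.norm_cp {d : LinkData} (hd : NonDeg d) :
    (cp₁ d).norm = Polynomial.C (cofSlope d.1 d.2)⁻¹ *
      (cof d.2 d.1 Polynomial.X * elimPoly d) ∧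
    (cp₂ d).norm = Polynomial.C (momSlope d.1)⁻¹ * (mom d.2 Polynomial.X * elimPoly d) := by
  obtain ⟨h₁, h₂, h₃, h₄⟩ := hd.conic_re_im
  have hβ := C_inv_mul hd.momSlope₁_ne
  have hδ := C_inv_mul hd.cofSlope₁_ne
  rw [QuadraticAlgebra.norm_def, QuadraticAlgebra.norm_def, h₁, h₂, h₃, h₄, elimPoly, conicRe,
    conicIm, mul_inv]
  simp only [Polynomial.C_mul, Polynomial.C_add, Polynomial.C_sub]
  clear h₁ h₂ h₃ h₄
  generalize sPoly d = s at *
  generalize tPoly d = t at *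
  generalize mom d.2 (Polynomial.X : ℝ[X]) = l at *
  generalize cof d.2 d.1 (Polynomial.X : ℝ[X]) = m at *
  generalize (Polynomial.C (momSlope d.1)⁻¹ : ℝ[X]) = b' at *
  generalize (Polynomial.C (momSlope d.1) : ℝ[X]) = b at *
  generalize (Polynomial.C (cofSlope d.1 d.2)⁻¹ : ℝ[X]) = e' at *
  generalize (Polynomial.C (cofSlope d.1 d.2) : ℝ[X]) = e at *
  generalize (Polynomial.C (momConst d.1) : ℝ[X]) = a at *
  generalize (Polynomial.C (cofConst d.1 d.2) : ℝ[X]) = c at *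
  constructor
  · linear_combination
      (-(b * c + a * e) * e' * (s * m + a * t) * t + e' * (l * m + a * c) * b * t ^ 2) * hβ
      + (-s ^ 2 * m ^ 2 - s * m * t * a - (s * m + a * t) * a * t) * hδ
  · linear_combination
      ((b * c + a * e) * b' * (l * t - c * s) * s + b' * (l * m + a * c) * e * s ^ 2) * hδ
      + (-t ^ 2 * l ^ 2 + s * l * t * c + (l * t - c * s) * c * s) * hβ

theorem NonDeg.uPoly_associated {d : LinkData} (hd : NonDeg d) :
    Associated (uPoly d) (elimPoly d) := by
  obtain ⟨hn₁, hn₂⟩ := hd.norm_cp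
  have hc := neg_ne_zero.mpr (mul_ne_zero hd.momSlope₁_ne hd.cofSlope₁_ne)
  have hunit : ∀ c : ℝ, c ≠ 0 → ∀ p : ℝ[X], Associated (Polynomial.C c * p) p := fun c hc p =>
    associated_unit_mul_left p _ (Polynomial.isUnit_C.mpr hc.isUnit)
  have h₁ : Associated (uRes₁ d) (cof d.2 d.1 Polynomial.X * elimPoly d) := by
    rw [uRes₁, hd.resultant_qPoly, map_pPoly₁, toConic_bρ₁, toConic_bρ₂, ← cp₁_eq, hn₁]
    exact (hunit _ (pow_ne_zero _ hc) _).trans (hunit _ (inv_ne_zero hd.cofSlope₁_ne) _)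
  have h₂ : Associated (uRes₂ d) (mom d.2 Polynomial.X * elimPoly d) := by
    rw [uRes₂, hd.resultant_qPoly, map_pPoly₂, toConic_bρ₁, toConic_bρ₂, ← cp₂_eq, hn₂]
    exact (hunit _ (pow_ne_zero _ hc) _).trans (hunit _ (inv_ne_zero hd.momSlope₁_ne) _)
  refine associated_of_dvd_dvd ?_ ?_
  · have g₁ := (EuclideanDomain.gcd_dvd_left (uRes₁ d) (uRes₂ d)).trans h₁.dvd
    have g₂ := (EuclideanDomain.gcd_dvd_right (uRes₁ d) (uRes₂ d)).trans h₂.dvd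
    have hinv := C_inv_mul hd.det_ne
    -- The polynomials l₂ and m₂ have degree at most 1, and the combination that removes ρ₂ is a
    -- constant, nonzero by `det_ne`.
    have h : elimPoly d = Polynomial.C (momConst d.2 * cofSlope d.2 d.1 -
          momSlope d.2 * cofConst d.2 d.1)⁻¹ *
        (Polynomial.C (cofSlope d.2 d.1) * (mom d.2 Polynomial.X * elimPoly d) -
          Polynomial.C (momSlope d.2) * (cof d.2 d.1 Polynomial.X * elimPoly d)) := by
      simp only [mom, cof, Polynomial.algebraMap_eq, Polynomial.C_sub, Polynomial.C_mul] at hinv ⊢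
      generalize elimPoly d = u at *
      linear_combination -u * hinv
    rw [h]
    exact Dvd.dvd.mul_left (dvd_sub (g₂.mul_left _) (g₁.mul_left _)) _
  · exact EuclideanDomain.dvd_gcd ((Dvd.intro_left _ rfl).trans h₁.symm.dvd)
      ((Dvd.intro_left _ rfl).trans h₂.symm.dvd)

/-! ### Solutions of the conservation laws -/

/-- The points at which the conservation laws hold. -/
def KeplerSol (d : LinkData) {R : Type} [CommRing R] [Algebra ℝ R] (v : Fin 6 → R) : Prop :=
  angMom d.1 (v 4) (v 0) = angMom d.2 (v 5) (v 1) ∧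
    lenz d.1 (v 4) (v 0) (v 2) = lenz d.2 (v 5) (v 1) (v 3) ∧
    energy d.1 (v 4) (v 0) (v 2) = energy d.2 (v 5) (v 1) (v 3)

/-- Homomorphisms that kill the ideal are the same as solutions of the conservation laws, so ideal
membership can be tested on solutions in suitable algebras. -/
theorem keplerIdeal_le_ker_iff (d : LinkData) {R : Type} [CommRing R] [Algebra ℝ R]
    (φ : Poly6 →ₐ[ℝ] R) :
    keplerIdeal d ≤ RingHom.ker φ ↔ KeplerSol d fun i => φ (MvPolynomial.X i) := by
  rw [keplerIdeal, Ideal.span_le, Set.union_subset_iff, Set.union_subset_iff,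
    Set.range_subset_iff, Set.range_subset_iff, Set.singleton_subset_iff, and_assoc]
  simp only [SetLike.mem_coe, RingHom.mem_ker, Pi.sub_apply, map_sub, map_angMom, map_lenz,
    map_energy, sub_eq_zero]
  exact and_congr funext_iff.symm (and_congr funext_iff.symm Iff.rfl)

theorem energy_eq_iff (a : EpochData) {R : Type} [CommRing R] [Algebra ℝ R] (ρ ρ' u h : R) :
    energy a ρ ρ' u = h ↔ u = energy a ρ ρ' 0 - h := by
  rw [energy, energy, sub_zero, sub_eq_iff_eq_add, eq_sub_iff_add_eq, add_comm u h, eq_comm]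

/-- The conservation laws are equivalent to a system in triangular form. -/
theorem NonDeg.exists_keplerSol_iff {d : LinkData} (hd : NonDeg d) :
    ∃ h : Fin 5 → ℝ[X], ∀ (R : Type) [CommRing R] [Algebra ℝ R] (v : Fin 6 → R),
      KeplerSol d v ↔ Polynomial.aeval (v (Fin.last 5)) (elimPoly d) = 0 ∧
        ∀ i : Fin 5, v i.castSucc = Polynomial.aeval (v (Fin.last 5)) (h i) := by
  obtain ⟨f, hf⟩ := hd.exists_planar_iff
  let y : ℝ[X] := Polynomial.X
  -- Back substitution: ρ₁ = f(ρ₂) determines the radial velocities, these determine the common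
  -- energy, and u_j is half the squared speed minus that energy.
  refine ⟨![rhoDot₁ d f y, rhoDot₂ d f y,
    energy d.1 f (rhoDot₁ d f y) 0 - commonEnergy d f y (rhoDot₁ d f y) (rhoDot₂ d f y),
    energy d.2 y (rhoDot₂ d f y) 0 - commonEnergy d f y (rhoDot₁ d f y) (rhoDot₂ d f y), f],
    fun R _ _ v => ?_⟩
  have h₁ := angMom_eq_iff hd.dCross_ne (v 4) (v 5) (v 0) (v 1)
  have h₂ := lenz_energy_iff hd.baseVolume_ne (v 4) (v 5) (v 0) (v 1) (v 2) (v 3)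
  have h₃ := hf R (v 4) (v 5)
  rw [KeplerSol, h₁, h₂]
  simp only [Fin.forall_fin_succ, IsEmpty.forall_iff, and_true]
  change _ ↔ Polynomial.aeval (v 5) (elimPoly d) = 0 ∧
    v 0 = Polynomial.aeval (v 5) (rhoDot₁ d f y) ∧
    v 1 = Polynomial.aeval (v 5) (rhoDot₂ d f y) ∧
    v 2 = Polynomial.aeval (v 5) (energy d.1 f (rhoDot₁ d f y) 0 -
      commonEnergy d f y (rhoDot₁ d f y) (rhoDot₂ d f y)) ∧
    v 3 = Polynomial.aeval (v 5) (energy d.2 y (rhoDot₂ d f y) 0 -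
      commonEnergy d f y (rhoDot₁ d f y) (rhoDot₂ d f y)) ∧
    v 4 = Polynomial.aeval (v 5) f
  simp only [map_sub, map_rhoDot₁, map_rhoDot₂, map_energy, map_commonEnergy, map_zero, y,
    Polynomial.aeval_X, energy_eq_iff]
  constructor
  · rintro ⟨⟨hq, e₀, e₁⟩, hp₁, hp₂, e₂, e₃⟩
    rw [e₀, e₁] at hp₁ hp₂
    obtain ⟨hu, e₄⟩ := h₃.mp ⟨hq, hp₁, hp₂⟩
    rw [e₀, e₁] at e₂ e₃
    rw [← e₄]
    exact ⟨hu, e₀, e₁, e₂, e₃, rfl⟩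
  · rintro ⟨hu, e₀, e₁, e₂, e₃, e₄⟩
    obtain ⟨hq, hp₁, hp₂⟩ := h₃.mpr ⟨hu, e₄⟩
    rw [← e₄] at e₀ e₁ e₂ e₃
    rw [← e₀, ← e₁] at e₂ e₃
    refine ⟨⟨hq, e₀, e₁⟩, ?_, ?_, e₂, e₃⟩
    · rw [e₀, e₁]
      exact hp₁
    · rw [e₀, e₁]
      exact hp₂

/-! ### Lexicographic Groebner bases of ideals in shape position -/

section Shape

open MvPolynomial MonomialOrder

variable {n : ℕ}

theorem coeff_aeval_X_last (p : ℝ[X]) (c : Fin (n + 1) →₀ ℕ) :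
    (Polynomial.aeval (X (Fin.last n) : MvPolynomial (Fin (n + 1)) ℝ) p).coeff c =
      if c = Finsupp.single (Fin.last n) (c (Fin.last n)) then p.coeff (c (Fin.last n))
      else 0 := by
  induction p using Polynomial.induction_on' with
  | add p q hp hq =>
    rw [map_add, coeff_add, hp, hq, Polynomial.coeff_add]
    split_ifs <;> simp
  | monomial k r =>
    rw [Polynomial.aeval_monomial, algebraMap_eq, coeff_C_mul, coeff_X_pow,
      Polynomial.coeff_monomial]
    by_cases hk : Finsupp.single (Fin.last n) k = c
    · subst hk
      simp
    · rw [if_neg hk, mul_zero]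
      split_ifs with h₁ h₂
      · exact absurd (h₂ ▸ h₁.symm) hk
      · rfl
      · rfl

theorem degree_aeval_X_last {p : ℝ[X]} (hp : p ≠ 0) :
    lex.degree (Polynomial.aeval (X (Fin.last n) : MvPolynomial (Fin (n + 1)) ℝ) p) =
      Finsupp.single (Fin.last n) p.natDegree := by
  apply lex.toSyn.injective
  refine le_antisymm (degree_le_iff.mpr fun c hc => ?_) (le_degree ?_)
  · rw [mem_support_iff, coeff_aeval_X_last] at hc
    split_ifs at hc with h
    · rw [h]
      have hle := Polynomial.le_natDegree_of_ne_zero hc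
      rw [← Nat.add_sub_cancel' hle, Finsupp.single_add]
      exact lex.le_add_right _ _
    · exact absurd rfl hc
  · rw [mem_support_iff, coeff_aeval_X_last]
    simpa using hp

/-- In the lexicographic order each earlier variable exceeds every power of the last one. -/
theorem degree_X_sub_aeval (i : Fin n) (p : ℝ[X]) :
    lex.degree (X i.castSucc - Polynomial.aeval (X (Fin.last n)) p :
      MvPolynomial (Fin (n + 1)) ℝ) = Finsupp.single i.castSucc 1 := by
  have hX : lex.degree (X i.castSucc : MvPolynomial (Fin (n + 1)) ℝ) =
      Finsupp.single i.castSucc 1 := degree_X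
  rw [sub_eq_add_neg, ← map_neg, degree_add_of_lt, hX]
  rw [hX]
  rcases eq_or_ne (-p) 0 with hp | hp
  · rw [hp, map_zero, degree_zero, map_zero, toSyn_lt_iff_ne_zero]
    simp
  · rw [degree_aeval_X_last hp, lex_lt_iff, Finsupp.Lex.lt_iff]
    refine ⟨i.castSucc, fun j hj => ?_, ?_⟩
    · have h₁ : j ≠ Fin.last n := (hj.trans (Fin.castSucc_lt_last i)).ne
      simp [h₁.symm, hj.ne']
    · simp

/-- The inequality between degrees is coordinatewise, not lexicographic; over a field the
coefficients do not obstruct divisibility. -/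
theorem leadingTerm_dvd_leadingTerm {f g : MvPolynomial (Fin (n + 1)) ℝ} (hg : g ≠ 0)
    (h : lex.degree g ≤ lex.degree f) : lex.leadingTerm g ∣ lex.leadingTerm f := by
  rw [leadingTerm, leadingTerm, monomial_dvd_monomial]
  exact ⟨Or.inr h, (leadingCoeff_ne_zero_iff.mpr hg).isUnit.dvd⟩

/-- A monomial containing an earlier variable is lexicographically larger than any power of the last
variable, so it cannot occur below such a leading monomial. -/
theorem exists_eq_aeval_X_last {f : MvPolynomial (Fin (n + 1)) ℝ}
    (hf : ∀ i : Fin n, lex.degree f i.castSucc = 0) :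
    ∃ p : ℝ[X], f = Polynomial.aeval (X (Fin.last n)) p := by
  refine ⟨∑ c ∈ f.support, Polynomial.monomial (c (Fin.last n)) (f.coeff c), ?_⟩
  conv_lhs => rw [f.as_sum]
  rw [map_sum]
  refine Finset.sum_congr rfl fun c hc => ?_
  have hc' : c = Finsupp.single (Fin.last n) (c (Fin.last n)) := by
    ext j
    refine Fin.lastCases ?_ (fun i => ?_) j
    · simp
    · rw [Finsupp.single_apply, if_neg (Fin.castSucc_lt_last i).ne']
      rcases (le_degree (m := lex) hc).eq_or_lt with h | h
      · rw [lex.toSyn.injective h, hf]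
      · rw [lex_lt_iff, Finsupp.Lex.lt_iff] at h
        obtain ⟨k, hk, hlt⟩ := h
        -- At the first place where the exponents differ, that of c is strictly smaller; this is
        -- impossible where the leading exponent is 0.
        have hlast : k = Fin.last n := by
          refine Fin.lastCases (fun _ => rfl) (fun k' hlt => ?_) k hlt
          rw [ofLex_toLex, ofLex_toLex, hf k'] at hlt
          omega
        have := hk i.castSucc (hlast ▸ Fin.castSucc_lt_last i)
        rw [ofLex_toLex, ofLex_toLex, hf i] at this
        exact this
  rw [Polynomial.aeval_monomial, algebraMap_eq, X_pow_eq_monomial, C_mul_monomial, mul_one, ← hc']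

/-- The elements `X i - h i (X n)` and `u (X n)` of an ideal form a lexicographic Groebner basis
if `u` generates the elimination ideal of the last variable. -/
theorem isGroebnerBasis_of_shape {I : Ideal (MvPolynomial (Fin (n + 1)) ℝ)} {u : ℝ[X]}
    {h : Fin n → ℝ[X]} (hu : u ≠ 0)
    (hX : ∀ i : Fin n, X i.castSucc - Polynomial.aeval (X (Fin.last n)) (h i) ∈ I)
    (hI : ∀ p : ℝ[X], Polynomial.aeval (X (Fin.last n)) p ∈ I ↔ u ∣ p) :
    IsGroebnerBasis lex I (Fin.snoc (α := fun _ => MvPolynomial (Fin (n + 1)) ℝ)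
      (fun i => X i.castSucc - Polynomial.aeval (X (Fin.last n)) (h i))
      (Polynomial.aeval (X (Fin.last n)) u)) := by
  refine ⟨fun i => ?_, fun f hf hf₀ => ?_⟩
  · refine Fin.lastCases ?_ (fun i => ?_) i
    · rw [Fin.snoc_last]
      exact (hI u).mpr dvd_rfl
    · rw [Fin.snoc_castSucc]
      exact hX i
  -- Either the leading monomial is a power of the last variable, and f lies in the elimination
  -- ideal generated by u, or it contains some earlier variable, which is itself the leading
  -- monomial of a basis element.
  · by_cases hdeg : ∀ i : Fin n, lex.degree f i.castSucc = 0
    · obtain ⟨p, rfl⟩ := exists_eq_aeval_X_last hdeg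
      have hp : p ≠ 0 := by
        rintro rfl
        exact hf₀ (map_zero _)
      refine ⟨Fin.last n, ?_⟩
      rw [Fin.snoc_last]
      have hdvd : u ∣ p := (hI p).mp hf
      obtain ⟨c, rfl⟩ := hdvd
      exact (leadingTerm_dvd_leadingTerm (by
        intro h₀
        rw [map_mul, h₀, zero_mul] at hf₀
        exact hf₀ rfl) (by
        rw [degree_aeval_X_last hu, degree_aeval_X_last hp, Finsupp.single_le_single]
        exact Polynomial.natDegree_le_of_dvd (Dvd.intro _ rfl) hp))
    · push Not at hdeg
      obtain ⟨i, hi⟩ := hdeg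
      refine ⟨i.castSucc, ?_⟩
      rw [Fin.snoc_castSucc]
      have hdi := degree_X_sub_aeval i (h i)
      refine leadingTerm_dvd_leadingTerm (lex.ne_zero_of_degree_ne_zero ?_) ?_
      · rw [hdi]
        simp
      · rw [hdi, Finsupp.single_le_iff]
        omega

theorem shape_injective {u : ℝ[X]} (h : Fin n → ℝ[X]) (hu : u ≠ 0) :
    Function.Injective (Fin.snoc (α := fun _ => MvPolynomial (Fin (n + 1)) ℝ)
      (fun i => X i.castSucc - Polynomial.aeval (X (Fin.last n)) (h i))
      (Polynomial.aeval (X (Fin.last n)) u)) := by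
  rw [Fin.snoc_injective_iff]
  refine ⟨fun i j hij => ?_, ?_⟩
  · have := congrArg lex.degree hij
    simp only [degree_X_sub_aeval] at this
    exact Fin.castSucc_injective n (Finsupp.single_left_injective one_ne_zero this)
  · rintro ⟨i, hi⟩
    have := congrArg lex.degree hi
    simp only [degree_X_sub_aeval, degree_aeval_X_last hu] at this
    have h₁ := DFunLike.congr_fun this i.castSucc
    simp at h₁

end Shape

/-- For nondegenerate data, `𝔲` has degree `9` and is the last element of a Groebner basis. -/
theorem NonDeg.groebner {d : LinkData} (hd : NonDeg d) {u : ℝ[X]}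
    (hu : Associated u (uPoly d)) :
    u.natDegree = 9 ∧ ∃ g : Fin 6 → Poly6, Function.Injective g ∧
      IsGroebnerBasis MonomialOrder.lex (keplerIdeal d) g ∧
      g 5 = Polynomial.aeval xρ₂ u := by
  have hu' := hu.trans hd.uPoly_associated
  have hdeg : u.natDegree = 9 := by
    rw [Polynomial.natDegree_eq_of_degree_eq (Polynomial.degree_eq_degree_of_associated hu'),
      hd.natDegree_elimPoly]
  have hu₀ : u ≠ 0 := by
    rintro rfl
    simp at hdeg
  obtain ⟨h, hh⟩ := hd.exists_keplerSol_iff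
  -- The residue classes of the variables modulo the ideal are the universal solution. The
  -- triangular relations hold for it, which puts the shape generators and the eliminant into the
  -- ideal.
  let π : Poly6 →ₐ[ℝ] Poly6 ⧸ keplerIdeal d := Ideal.Quotient.mkₐ ℝ (keplerIdeal d)
  have hπ : ∀ f, π f = 0 ↔ f ∈ keplerIdeal d := fun f => Ideal.Quotient.eq_zero_iff_mem
  obtain ⟨hπu, hπh⟩ := (hh _ _).mp ((keplerIdeal_le_ker_iff d π).mp fun f hf => (hπ f).mpr hf)
  rw [Polynomial.aeval_algHom_apply, hπ] at hπu
  have hX : ∀ i : Fin 5, (MvPolynomial.X i.castSucc : Poly6) -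
      Polynomial.aeval (MvPolynomial.X (Fin.last 5)) (h i) ∈ keplerIdeal d := fun i => by
    rw [← hπ, map_sub, hπh, Polynomial.aeval_algHom_apply, sub_self]
  have hI : ∀ p : ℝ[X], Polynomial.aeval (MvPolynomial.X (Fin.last 5) : Poly6) p ∈
      keplerIdeal d ↔ u ∣ p := fun p => by
    rw [hu'.dvd_iff_dvd_left]
    constructor
    · intro hp
      -- Conversely, the root of the eliminant in ℝ[X]/(`elimPoly d`) extends to a solution.
      -- Evaluation there kills the ideal, so a polynomial in ρ₂ that belongs to the ideal is a
      -- multiple of the eliminant; no squarefreeness is needed.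
      let v : Fin 6 → AdjoinRoot (elimPoly d) :=
        Fin.snoc (α := fun _ => AdjoinRoot (elimPoly d))
          (fun i => Polynomial.aeval (AdjoinRoot.root (elimPoly d)) (h i))
          (AdjoinRoot.root (elimPoly d))
      have hv₅ : v (Fin.last 5) = AdjoinRoot.root (elimPoly d) :=
        Fin.snoc_last (α := fun _ => AdjoinRoot (elimPoly d)) _ _
      have hvi : ∀ i : Fin 5, v i.castSucc =
          Polynomial.aeval (AdjoinRoot.root (elimPoly d)) (h i) := fun i =>
        Fin.snoc_castSucc (α := fun _ => AdjoinRoot (elimPoly d)) _ _ i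
      have hv : keplerIdeal d ≤ RingHom.ker (MvPolynomial.aeval (R := ℝ) v) := by
        rw [keplerIdeal_le_ker_iff, hh]
        simp only [MvPolynomial.aeval_X, hv₅, hvi, implies_true, and_true]
        rw [AdjoinRoot.aeval_eq, AdjoinRoot.mk_self]
      have := hv hp
      rw [RingHom.mem_ker, ← Polynomial.aeval_algHom_apply, MvPolynomial.aeval_X, hv₅,
        AdjoinRoot.aeval_eq, AdjoinRoot.mk_eq_zero] at this
      exact this
    · rintro ⟨c, rfl⟩
      rw [map_mul]
      exact Ideal.mul_mem_right _ _ hπu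
  exact ⟨hdeg, _, shape_injective h hu₀, isGroebnerBasis_of_shape hu₀ hX hI,
    Fin.snoc_last (α := fun _ => Poly6) _ _⟩

/-! ### Nondegenerate data -/

/-- A nondegenerate point of the data space. -/
def sampleData : LinkData :=
  ((![0, 0, 1, 0], ![1, 1, 1], ![0, 0, 0]),
    -- Right ascension π/2 and declination 0 place the second line of sight on the second coordinate
    -- axis, so that all the vectors have integer entries.
    (![Real.pi / 2, 0, 0, 1], ![-1, 0, -1], ![1, 0, 0]))

namespace Sample

theorem eRho₁ : sampleData.1.eRho = ![1, 0, 0] := by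
  simp [sampleData, EpochData.eRho, EpochData.dec, EpochData.ra]

theorem eRho₂ : sampleData.2.eRho = ![0, 1, 0] := by
  simp [sampleData, EpochData.eRho, EpochData.dec, EpochData.ra]

theorem eta₁ : sampleData.1.eta = ![0, 1, 0] := by
  simp [sampleData, EpochData.eta, EpochData.eAlpha, EpochData.eDelta, EpochData.dec,
    EpochData.ra, EpochData.raRate, EpochData.decRate]

theorem eta₂ : sampleData.2.eta = ![0, 0, 1] := by
  simp [sampleData, EpochData.eta, EpochData.eAlpha, EpochData.eDelta, EpochData.dec,
    EpochData.ra, EpochData.raRate, EpochData.decRate]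

theorem obsPos₁ : sampleData.1.obsPos = ![1, 1, 1] := rfl

theorem obsPos₂ : sampleData.2.obsPos = ![-1, 0, -1] := rfl

theorem obsVel₁ : sampleData.1.obsVel = ![0, 0, 0] := rfl

theorem obsVel₂ : sampleData.2.obsVel = ![1, 0, 0] := rfl

theorem vD₁ : sampleData.1.vD = ![0, 1, -1] := by
  simp [EpochData.vD, eRho₁, obsPos₁, cross_apply]

theorem vD₂ : sampleData.2.vD = ![1, 0, -1] := by
  simp [EpochData.vD, eRho₂, obsPos₂, cross_apply]

theorem vE₁ : sampleData.1.vE = ![0, 0, 1] := by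
  simp [EpochData.vE, eRho₁, eta₁, cross_apply]

theorem vE₂ : sampleData.2.vE = ![1, 0, 0] := by
  simp [EpochData.vE, eRho₂, eta₂, cross_apply]

theorem vF₁ : sampleData.1.vF = ![-1, 0, 1] := by
  simp [EpochData.vF, eRho₁, eta₁, obsPos₁, obsVel₁, cross_apply]

theorem vF₂ : sampleData.2.vF = ![0, 1, -1] := by
  simp [EpochData.vF, eRho₂, eta₂, obsPos₂, obsVel₂, cross_apply]

theorem vG₁ : sampleData.1.vG = ![0, 0, 0] := by
  simp [EpochData.vG, obsPos₁, obsVel₁, cross_apply]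

theorem vG₂ : sampleData.2.vG = ![0, -1, 0] := by
  simp [EpochData.vG, obsPos₂, obsVel₂, cross_apply]

theorem dCross_eq : dCross sampleData = ![-1, -1, -1] := by
  simp [dCross, vD₁, vD₂, cross_apply]

theorem momSlope₁ : momSlope sampleData.1 = -1 := by
  simp [momSlope, eRho₁, eta₁, obsPos₁, cross_apply]

theorem momConst₁ : momConst sampleData.1 = 0 := by
  simp [momConst, eRho₁, obsVel₁, obsPos₁, cross_apply]

theorem momSlope₂ : momSlope sampleData.2 = 1 := by
  simp [momSlope, eRho₂, eta₂, obsPos₂, cross_apply]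

theorem momConst₂ : momConst sampleData.2 = -1 := by
  simp [momConst, eRho₂, obsVel₂, obsPos₂, cross_apply]

theorem cofSlope₁ : cofSlope sampleData.1 sampleData.2 = 1 := by
  simp [cofSlope, eRho₁, vD₂]

theorem cofConst₁ : cofConst sampleData.1 sampleData.2 = 0 := by
  simp [cofConst, obsPos₁, vD₂]

theorem cofSlope₂ : cofSlope sampleData.2 sampleData.1 = 1 := by
  simp [cofSlope, eRho₂, vD₁]

theorem cofConst₂ : cofConst sampleData.2 sampleData.1 = 1 := by
  simp [cofConst, obsPos₂, vD₁]

theorem dCross_ne : dCross sampleData ⬝ᵥ dCross sampleData ≠ 0 := by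
  simp [dCross_eq]
  norm_num

theorem baseVolume_ne : baseVolume sampleData ≠ 0 := by
  simp [baseVolume, obsPos₁, obsPos₂, eRho₁, eRho₂, cross_apply]

variable {R : Type} [CommRing R] [Algebra ℝ R] {x y : R}

/-- The sample conic is ρ₁² = ρ₂² − 1; using it removes the denominator |D₁ × D₂|² = 3. -/
theorem rhoDot_eq (h : qPoly sampleData x y = 0) :
    rhoDot₁ sampleData x y = y - 1 ∧ rhoDot₂ sampleData x y = -(y ^ 2 + x) := by
  have h₃ : algebraMap ℝ R 3⁻¹ * 3 = 1 := by
    have := algebraMap_inv_mul (R := R) (three_ne_zero (α := ℝ))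
    rwa [map_ofNat] at this
  have hN : dCross sampleData ⬝ᵥ dCross sampleData = 3 := by
    simp [dCross_eq]
    norm_num
  rw [qPoly_eq, mom, mom, cof, cof, momSlope₁, momConst₁, momSlope₂, momConst₂, cofSlope₁,
    cofConst₁, cofSlope₂, cofConst₂] at h
  simp only [map_neg, map_one, map_zero] at h
  constructor
  · rw [rhoDot₁, hN, Algebra.smul_def (3⁻¹ : ℝ)]
    simp [dot_eq, cross_zero, cross_one, cross_two, vJ, emb, vD₂, vE₁, vE₂, vF₁, vF₂, vG₁, vG₂,
      dCross_eq]
    linear_combination (y - 1) * h₃ + algebraMap ℝ R 3⁻¹ * h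
  · rw [rhoDot₂, hN, Algebra.smul_def (3⁻¹ : ℝ)]
    simp [dot_eq, cross_zero, cross_one, cross_two, vJ, emb, vD₁, vE₁, vE₂, vF₁, vF₂, vG₁, vG₂,
      dCross_eq]
    linear_combination -(y ^ 2 + x) * h₃ - algebraMap ℝ R 3⁻¹ * h

theorem pPoly_eq (h : qPoly sampleData x y = 0) :
    pPoly₁ sampleData x y = (y ^ 2 + algebraMap ℝ R (1 / 2) * y ^ 4) * (y + 1) +
      (4 + 2 * y ^ 3) * x ∧
    pPoly₂ sampleData x y = -((4 + 2 * y ^ 3) * (y - 1)) +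
      -(y ^ 2 + algebraMap ℝ R (1 / 2) * y ^ 4) * x := by
  obtain ⟨h₁, h₂⟩ := rhoDot_eq h
  have hr₁ : pos sampleData.1 x = ![x + 1, 1, 1] := by
    ext i
    fin_cases i <;> simp [pos, emb, eRho₁, obsPos₁]
  have hr₂ : pos sampleData.2 y = ![-1, y, -1] := by
    ext i
    fin_cases i <;> simp [pos, emb, eRho₂, obsPos₂]
  have hv₁ : vel sampleData.1 x (y - 1) = ![y - 1, x, 0] := by
    ext i
    fin_cases i <;> simp [vel, emb, eRho₁, eta₁, obsVel₁]
  have hv₂ : vel sampleData.2 y (-(y ^ 2 + x)) = ![1, -(y ^ 2 + x), y] := by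
    ext i
    fin_cases i <;> simp [vel, emb, eRho₂, eta₂, obsVel₂]
  have h2 : algebraMap ℝ R (1 / 2) * 2 = 1 := by
    have := algebraMap_inv_mul (R := R) (two_ne_zero (α := ℝ))
    rwa [map_ofNat, inv_eq_one_div] at this
  have e₁ : ∀ v : Fin 3 → R, v ⬝ᵥ emb R sampleData.1.eRho = v 0 := fun v => by
    simp [dot_eq, emb, eRho₁]
  have e₂ : ∀ v : Fin 3 → R, v ⬝ᵥ emb R sampleData.2.eRho = v 1 := fun v => by
    simp [dot_eq, emb, eRho₂]
  rw [pPoly₁, pPoly₂, xiElim, xi_eq, h₁, h₂, e₁, e₂]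
  simp only [redLenz, hr₁, hr₂, hv₁, hv₂, cross_zero, cross_one, Pi.sub_apply, Pi.smul_apply,
    smul_eq_mul, dot_eq, Algebra.smul_def (1 / 2 : ℝ)]
  simp only [Matrix.cons_val_zero, Matrix.cons_val_one, Matrix.cons_val]
  generalize algebraMap ℝ R (1 / 2) = k at *
  constructor
  · linear_combination (y ^ 2 * (y + 1) + (4 + 2 * y ^ 3) * x + 2 * (((x + 1) * (y - 1) + x) * x -
      (-1 - y * (y ^ 2 + x) - y) * -(y ^ 2 + x)) + (1 - y) * ((-1 - y * (y ^ 2 + x) - y) * y)) * h2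
  · linear_combination (-((4 + 2 * y ^ 3) * (y - 1)) - y ^ 2 * x -
      (-1 - y * (y ^ 2 + x) - y) * y * (x + 2) -
      2 * (((x + 1) * (y - 1) + x) * (y - 1) - (-1 - y * (y ^ 2 + x) - y))) * h2

theorem aeval_cρ₂ (d : LinkData) (p : ℝ[X]) :
    Polynomial.aeval (cρ₂ d) p = (⟨p, 0⟩ : Conic d) := by
  have : cρ₂ d = algebraMap ℝ[X] (Conic d) Polynomial.X := rfl
  rw [this, Polynomial.aeval_algebraMap_apply, Polynomial.aeval_X_left_apply]
  rfl

theorem im_aeval (d : LinkData) (p r : ℝ[X]) :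
    (Polynomial.aeval (cρ₂ d) p + Polynomial.aeval (cρ₂ d) r * cρ₁ d).im = r := by
  simp [aeval_cρ₂, cρ₁]

theorem tPoly_eq : tPoly sampleData = -(4 + 2 * Polynomial.X ^ 3) := by
  have h := qPoly_conic (d := sampleData) (by simp [momSlope₁]) (by simp [cofSlope₁])
  have him := im_aeval sampleData
    ((Polynomial.X ^ 2 + Polynomial.C (1 / 2) * Polynomial.X ^ 4) * (Polynomial.X + 1))
    (4 + 2 * Polynomial.X ^ 3)
  simp only [map_add, map_mul, map_pow, map_ofNat, map_one, Polynomial.aeval_X,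
    Polynomial.aeval_C] at him
  rw [tPoly, cp₁_eq, (pPoly_eq h).1, him, momSlope₁]
  simp

theorem sPoly_eq : sPoly sampleData =
    Polynomial.X ^ 2 + Polynomial.C (1 / 2) * Polynomial.X ^ 4 := by
  have h := qPoly_conic (d := sampleData) (by simp [momSlope₁]) (by simp [cofSlope₁])
  have him := im_aeval sampleData (-((4 + 2 * Polynomial.X ^ 3) * (Polynomial.X - 1)))
    (-(Polynomial.X ^ 2 + Polynomial.C (1 / 2) * Polynomial.X ^ 4))
  simp only [map_add, map_sub, map_neg, map_mul, map_pow, map_ofNat, map_one, Polynomial.aeval_X,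
    Polynomial.aeval_C] at him
  rw [sPoly, cp₂_eq, (pPoly_eq h).2, him, cofSlope₁]
  simp

end Sample

namespace Sample

theorem natDegree_tPoly : (tPoly sampleData).natDegree = 3 := by
  rw [tPoly_eq, Polynomial.natDegree_neg]
  compute_degree!

theorem natDegree_sPoly : (sPoly sampleData).natDegree = 4 := by
  rw [sPoly_eq]
  compute_degree!

theorem coeff_sPoly : (sPoly sampleData).coeff 4 = 1 / 2 := by
  rw [sPoly_eq]
  simp [Polynomial.coeff_X_pow]

theorem coeff_tPoly : (tPoly sampleData).coeff 4 = 0 :=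
  Polynomial.coeff_eq_zero_of_natDegree_lt (by rw [natDegree_tPoly]; norm_num)

theorem coprime : IsCoprime (sPoly sampleData) (tPoly sampleData) := by
  have h₂ : (Polynomial.C (1 / 2) : ℝ[X]) = 12 * Polynomial.C (1 / 24) := by
    rw [← Polynomial.C_ofNat, ← Polynomial.C_mul]
    norm_num
  have h₂₄ : (24 : ℝ[X]) * Polynomial.C (1 / 24) = 1 := by
    rw [← Polynomial.C_ofNat, ← Polynomial.C_mul]
    norm_num
  rw [sPoly_eq, tPoly_eq, h₂]
  -- An explicit Bézout relation for s = X² + X⁴/2 and t = −(4 + 2X³), with common denominator 24.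
  refine ⟨4 * Polynomial.C (1 / 24) * (Polynomial.X ^ 2 - 2 * Polynomial.X - 2),
    Polynomial.C (1 / 24) * (Polynomial.X ^ 3 - 2 * Polynomial.X ^ 2 - 6), ?_⟩
  generalize (Polynomial.C (1 / 24) : ℝ[X]) = k at *
  linear_combination (1 + 2 * k * (Polynomial.X ^ 2 - 2 * Polynomial.X - 2) *
    Polynomial.X ^ 4) * h₂₄

/-- At the sample point t has degree 3 only. Raising its formal degree to 4 multiplies the resultant
by the leading coefficient 1/2 of s up to sign, so it stays nonzero. -/
theorem resultant_ne_zero : (sPoly sampleData).resultant (tPoly sampleData) 4 4 ≠ 0 := by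
  have h := Polynomial.resultant_ne_zero _ _ coprime
  rw [natDegree_sPoly, natDegree_tPoly] at h
  rw [Polynomial.resultant_add_right_deg (n := 3) _ _ _ 1 natDegree_tPoly.le, coeff_sPoly]
  exact mul_ne_zero (by norm_num) h

end Sample

/-! ### Genericity -/

/-- A property that holds outside the zero set of an analytic function not vanishing at `d₀`. -/
def GenericAt (d₀ : LinkData) (P : LinkData → Prop) : Prop :=
  ∃ F : LinkData → ℝ, AnalyticOnNhd ℝ F Set.univ ∧ F d₀ ≠ 0 ∧ ∀ d, F d ≠ 0 → P d

theorem GenericAt.generic {d₀ : LinkData} {P : LinkData → Prop} (h : GenericAt d₀ P) :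
    Generic P := by
  obtain ⟨F, hF, h₀, hP⟩ := h
  exact ⟨F, hF, ⟨d₀, h₀⟩, hP⟩

/-- Keeping the base point fixed makes the product of the two analytic functions nonzero at once. -/
theorem GenericAt.and {d₀ : LinkData} {P Q : LinkData → Prop} (hP : GenericAt d₀ P)
    (hQ : GenericAt d₀ Q) : GenericAt d₀ fun d => P d ∧ Q d := by
  obtain ⟨F, hF, h₀, hP⟩ := hP
  obtain ⟨G, hG, h₁, hQ⟩ := hQ
  exact ⟨fun d => F d * G d, hF.mul hG, mul_ne_zero h₀ h₁, fun d hd =>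
    ⟨hP d (left_ne_zero_of_mul hd), hQ d (right_ne_zero_of_mul hd)⟩⟩

theorem GenericAt.mono {d₀ : LinkData} {P Q : LinkData → Prop} (hP : GenericAt d₀ P)
    (h : ∀ d, P d → Q d) : GenericAt d₀ Q := by
  obtain ⟨F, hF, h₀, hP⟩ := hP
  exact ⟨F, hF, h₀, fun d hd => h d (hP d hd)⟩

/-- A quotient of analytic functions whose denominator does not vanish at `d₀`. -/
def Regular (d₀ : LinkData) (f : LinkData → ℝ) : Prop :=
  ∃ N D : LinkData → ℝ, AnalyticOnNhd ℝ N Set.univ ∧ AnalyticOnNhd ℝ D Set.univ ∧ D d₀ ≠ 0 ∧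
    ∀ d, D d ≠ 0 → f d * D d = N d

/-! ### Arithmetic of quotients of analytic functions -/

namespace Regular

variable {d₀ : LinkData} {f g : LinkData → ℝ}

theorem of_analytic (hf : AnalyticOnNhd ℝ f Set.univ) : Regular d₀ f :=
  ⟨f, fun _ => 1, hf, analyticOnNhd_const, one_ne_zero, fun _ _ => mul_one _⟩

theorem const (c : ℝ) : Regular d₀ fun _ => c := of_analytic analyticOnNhd_const

theorem add (hf : Regular d₀ f) (hg : Regular d₀ g) : Regular d₀ fun d => f d + g d := by
  obtain ⟨N, D, hN, hD, h₀, h⟩ := hf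
  obtain ⟨N', D', hN', hD', h₀', h'⟩ := hg
  refine ⟨fun d => N d * D' d + N' d * D d, fun d => D d * D' d,
    (hN.mul hD').add (hN'.mul hD), hD.mul hD', mul_ne_zero h₀ h₀', fun d hd => ?_⟩
  linear_combination D' d * h d (left_ne_zero_of_mul hd) + D d * h' d (right_ne_zero_of_mul hd)

theorem mul (hf : Regular d₀ f) (hg : Regular d₀ g) : Regular d₀ fun d => f d * g d := by
  obtain ⟨N, D, hN, hD, h₀, h⟩ := hf
  obtain ⟨N', D', hN', hD', h₀', h'⟩ := hg
  refine ⟨fun d => N d * N' d, fun d => D d * D' d, hN.mul hN', hD.mul hD',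
    mul_ne_zero h₀ h₀', fun d hd => ?_⟩
  change f d * g d * (D d * D' d) = N d * N' d
  rw [← h d (left_ne_zero_of_mul hd), ← h' d (right_ne_zero_of_mul hd)]
  ring

theorem neg (hf : Regular d₀ f) : Regular d₀ fun d => -f d := by
  simpa using (const (-1)).mul hf

theorem sub (hf : Regular d₀ f) (hg : Regular d₀ g) : Regular d₀ fun d => f d - g d := by
  simpa only [sub_eq_add_neg] using hf.add hg.neg

theorem pow (hf : Regular d₀ f) (n : ℕ) : Regular d₀ fun d => f d ^ n := by
  induction n with
  | zero => simpa using const 1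
  | succ n ih => simpa only [pow_succ] using ih.mul hf

theorem sum {ι : Type} (s : Finset ι) {f : ι → LinkData → ℝ} (hf : ∀ i ∈ s, Regular d₀ (f i)) :
    Regular d₀ fun d => ∑ i ∈ s, f i d := by
  classical
  induction s using Finset.induction_on with
  | empty => simpa using const 0
  | insert a s ha ih =>
    simp only [Finset.sum_insert ha]
    exact (hf a (Finset.mem_insert_self a s)).add
      (ih fun i hi => hf i (Finset.mem_insert_of_mem hi))

theorem prod {ι : Type} (s : Finset ι) {f : ι → LinkData → ℝ}
    (hf : ∀ i ∈ s, Regular d₀ (f i)) : Regular d₀ fun d => ∏ i ∈ s, f i d := by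
  classical
  induction s using Finset.induction_on with
  | empty => simpa using const 1
  | insert a s ha ih =>
    simp only [Finset.prod_insert ha]
    exact (hf a (Finset.mem_insert_self a s)).mul
      (ih fun i hi => hf i (Finset.mem_insert_of_mem hi))

theorem inv (hf : Regular d₀ f) (h₀ : f d₀ ≠ 0) : Regular d₀ fun d => (f d)⁻¹ := by
  obtain ⟨N, D, hN, hD, hD₀, h⟩ := hf
  -- The inverse is written D²/(N D) rather than D/N, so that where the new denominator is nonzero
  -- the old relation f D = N is available.
  refine ⟨fun d => D d * D d, fun d => N d * D d, hD.mul hD, hN.mul hD,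
    mul_ne_zero (h d₀ hD₀ ▸ mul_ne_zero h₀ hD₀) hD₀, fun d hd => ?_⟩
  have hD' := right_ne_zero_of_mul hd
  have hN' := left_ne_zero_of_mul hd
  rw [← h d hD'] at hN'
  change (f d)⁻¹ * (N d * D d) = D d * D d
  rw [← h d hD', mul_assoc, inv_mul_cancel_left₀ (left_ne_zero_of_mul hN')]

theorem genericAt (hf : Regular d₀ f) (h₀ : f d₀ ≠ 0) : GenericAt d₀ fun d => f d ≠ 0 := by
  obtain ⟨N, D, hN, hD, hD₀, h⟩ := hf
  refine ⟨fun d => N d * D d, hN.mul hD, mul_ne_zero (h d₀ hD₀ ▸ mul_ne_zero h₀ hD₀) hD₀,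
    fun d hd hf => left_ne_zero_of_mul hd ?_⟩
  rw [← h d (right_ne_zero_of_mul hd), hf, zero_mul]

theorem det {n : ℕ} {M : LinkData → Matrix (Fin n) (Fin n) ℝ}
    (hM : ∀ i j, Regular d₀ fun d => M d i j) : Regular d₀ fun d => (M d).det := by
  simp only [Matrix.det_apply']
  exact sum _ fun σ _ => (const _).mul (prod _ fun i _ => hM _ _)

theorem dot {x y : LinkData → Fin 3 → ℝ} (hx : ∀ i, Regular d₀ fun d => x d i)
    (hy : ∀ i, Regular d₀ fun d => y d i) : Regular d₀ fun d => x d ⬝ᵥ y d := by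
  simp only [dot_eq]
  exact (((hx 0).mul (hy 0)).add ((hx 1).mul (hy 1))).add ((hx 2).mul (hy 2))

theorem cross {x y : LinkData → Fin 3 → ℝ} (hx : ∀ i, Regular d₀ fun d => x d i)
    (hy : ∀ i, Regular d₀ fun d => y d i) (i : Fin 3) :
    Regular d₀ fun d => (x d ⨯₃ y d) i := by
  fin_cases i <;> simp only [Fin.zero_eta, Fin.mk_one, Fin.reduceFinMk]
  · simp only [cross_zero]
    exact ((hx 1).mul (hy 2)).sub ((hx 2).mul (hy 1))
  · simp only [cross_one]
    exact ((hx 2).mul (hy 0)).sub ((hx 0).mul (hy 2))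
  · simp only [cross_two]
    exact ((hx 0).mul (hy 1)).sub ((hx 1).mul (hy 0))

section Epoch

variable {a b : LinkData → EpochData}

theorem coord (ha : AnalyticOnNhd ℝ a Set.univ) (i : Fin 4) :
    AnalyticOnNhd ℝ (fun d => (a d).1 i) Set.univ := fun d hd =>
  ((ContinuousLinearMap.proj (R := ℝ) (φ := fun _ : Fin 4 => ℝ) i).analyticAt _).comp
    (analyticAt_fst.comp (ha d hd))

theorem obsPos (ha : AnalyticOnNhd ℝ a Set.univ) (i : Fin 3) : Regular d₀ fun d => (a d).obsPos i :=
  of_analytic fun d hd =>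
    ((ContinuousLinearMap.proj (R := ℝ) (φ := fun _ : Fin 3 => ℝ) i).analyticAt _).comp
      (analyticAt_fst.comp (analyticAt_snd.comp (ha d hd)))

theorem obsVel (ha : AnalyticOnNhd ℝ a Set.univ) (i : Fin 3) : Regular d₀ fun d => (a d).obsVel i :=
  of_analytic fun d hd =>
    ((ContinuousLinearMap.proj (R := ℝ) (φ := fun _ : Fin 3 => ℝ) i).analyticAt _).comp
      (analyticAt_snd.comp (analyticAt_snd.comp (ha d hd)))

theorem cos_coord (ha : AnalyticOnNhd ℝ a Set.univ) (i : Fin 4) :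
    Regular d₀ fun d => Real.cos ((a d).1 i) :=
  of_analytic fun d hd => Real.analyticAt_cos.comp (coord ha i d hd)

theorem sin_coord (ha : AnalyticOnNhd ℝ a Set.univ) (i : Fin 4) :
    Regular d₀ fun d => Real.sin ((a d).1 i) :=
  of_analytic fun d hd => Real.analyticAt_sin.comp (coord ha i d hd)

theorem eRho (ha : AnalyticOnNhd ℝ a Set.univ) (i : Fin 3) : Regular d₀ fun d => (a d).eRho i := by
  fin_cases i
  · exact (cos_coord ha 1).mul (cos_coord ha 0)
  · exact (cos_coord ha 1).mul (sin_coord ha 0)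
  · exact sin_coord ha 1

theorem eAlpha (ha : AnalyticOnNhd ℝ a Set.univ) (i : Fin 3) :
    Regular d₀ fun d => (a d).eAlpha i := by
  fin_cases i
  · exact (sin_coord ha 0).neg
  · exact cos_coord ha 0
  · exact const 0

theorem eDelta (ha : AnalyticOnNhd ℝ a Set.univ) (i : Fin 3) :
    Regular d₀ fun d => (a d).eDelta i := by
  fin_cases i
  · exact ((sin_coord ha 1).mul (cos_coord ha 0)).neg
  · exact ((sin_coord ha 1).mul (sin_coord ha 0)).neg
  · exact cos_coord ha 1

theorem eta (ha : AnalyticOnNhd ℝ a Set.univ) (i : Fin 3) : Regular d₀ fun d => (a d).eta i :=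
  (((of_analytic (coord ha 2)).mul (cos_coord ha 1)).mul (eAlpha ha i)).add
    ((of_analytic (coord ha 3)).mul (eDelta ha i))

theorem vD (ha : AnalyticOnNhd ℝ a Set.univ) (i : Fin 3) : Regular d₀ fun d => (a d).vD i :=
  cross (obsPos ha) (eRho ha) i

theorem vE (ha : AnalyticOnNhd ℝ a Set.univ) (i : Fin 3) : Regular d₀ fun d => (a d).vE i :=
  cross (eRho ha) (eta ha) i

theorem vF (ha : AnalyticOnNhd ℝ a Set.univ) (i : Fin 3) : Regular d₀ fun d => (a d).vF i :=
  (cross (obsPos ha) (eta ha) i).add (cross (eRho ha) (obsVel ha) i)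

theorem vG (ha : AnalyticOnNhd ℝ a Set.univ) (i : Fin 3) : Regular d₀ fun d => (a d).vG i :=
  cross (obsPos ha) (obsVel ha) i

theorem momSlope (ha : AnalyticOnNhd ℝ a Set.univ) : Regular d₀ fun d => momSlope (a d) :=
  dot (cross (obsPos ha) (eta ha)) (eRho ha)

theorem momConst (ha : AnalyticOnNhd ℝ a Set.univ) : Regular d₀ fun d => momConst (a d) :=
  dot (cross (obsPos ha) (obsVel ha)) (eRho ha)

theorem cofSlope (ha : AnalyticOnNhd ℝ a Set.univ) (hb : AnalyticOnNhd ℝ b Set.univ) :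
    Regular d₀ fun d => cofSlope (a d) (b d) :=
  dot (eRho ha) (vD hb)

theorem cofConst (ha : AnalyticOnNhd ℝ a Set.univ) (hb : AnalyticOnNhd ℝ b Set.univ) :
    Regular d₀ fun d => cofConst (a d) (b d) :=
  dot (obsPos ha) (vD hb)

end Epoch

end Regular

/-- A family of polynomials whose coefficients are regular at `d₀`. -/
def RegularPoly (d₀ : LinkData) (p : LinkData → ℝ[X]) : Prop :=
  ∀ k, Regular d₀ fun d => (p d).coeff k

namespace RegularPoly

variable {d₀ : LinkData} {p r : LinkData → ℝ[X]}

theorem fixed (p : ℝ[X]) : RegularPoly d₀ fun _ => p := fun _ => .const _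

theorem C {c : LinkData → ℝ} (hc : Regular d₀ c) :
    RegularPoly d₀ fun d => Polynomial.C (c d) := fun k => by
  simp only [Polynomial.coeff_C]
  split_ifs
  exacts [hc, .const 0]

theorem add (hp : RegularPoly d₀ p) (hr : RegularPoly d₀ r) :
    RegularPoly d₀ fun d => p d + r d := fun k => by
  simpa only [Polynomial.coeff_add] using (hp k).add (hr k)

theorem neg (hp : RegularPoly d₀ p) : RegularPoly d₀ fun d => -p d := fun k => by
  simpa only [Polynomial.coeff_neg] using (hp k).neg

theorem mul (hp : RegularPoly d₀ p) (hr : RegularPoly d₀ r) :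
    RegularPoly d₀ fun d => p d * r d := fun k => by
  simp only [Polynomial.coeff_mul]
  exact .sum _ fun i _ => (hp i.1).mul (hr i.2)

/-- With the formal degrees fixed, the Sylvester matrix has constant size and its entries are
coefficients or 0, even where the actual degrees drop. -/
theorem resultant (hp : RegularPoly d₀ p) (hr : RegularPoly d₀ r) (m n : ℕ) :
    Regular d₀ fun d => (p d).resultant (r d) m n := by
  refine Regular.det fun i j => ?_
  induction j using Fin.addCases with
  | left j =>
    simp only [Polynomial.sylvester, Matrix.of_apply, Fin.addCases_left]
    split_ifs
    exacts [hr _, .const 0]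
  | right j =>
    simp only [Polynomial.sylvester, Matrix.of_apply, Fin.addCases_right]
    split_ifs
    exacts [hp _, .const 0]

end RegularPoly

/-- The conditions on `d₀` under which the family of conics is regular at `d₀`. -/
structure RegularPoint (d₀ : LinkData) : Prop where
  dCross_ne : dCross d₀ ⬝ᵥ dCross d₀ ≠ 0
  momSlope₁_ne : momSlope d₀.1 ≠ 0
  cofSlope₁_ne : cofSlope d₀.1 d₀.2 ≠ 0

/-- A family of functions on the conics with coefficients regular at `d₀`. -/
def RegularConic (d₀ : LinkData) (z : ∀ d, Conic d) : Prop :=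
  (RegularPoly d₀ fun d => (z d).re) ∧ RegularPoly d₀ fun d => (z d).im

theorem analytic_fst : AnalyticOnNhd ℝ (Prod.fst : LinkData → EpochData) Set.univ :=
  fun _ _ => analyticAt_fst

theorem analytic_snd : AnalyticOnNhd ℝ (Prod.snd : LinkData → EpochData) Set.univ :=
  fun _ _ => analyticAt_snd

namespace RegularPoint

variable {d₀ : LinkData}

theorem regular_inv_mul (h₀ : RegularPoint d₀) :
    Regular d₀ fun d => (momSlope d.1 * cofSlope d.1 d.2)⁻¹ :=
  ((Regular.momSlope analytic_fst).mul (Regular.cofSlope analytic_fst analytic_snd)).inv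
    (mul_ne_zero h₀.momSlope₁_ne h₀.cofSlope₁_ne)

theorem regular_conicRe (h₀ : RegularPoint d₀) : RegularPoly d₀ fun d => conicRe d := by
  have hm : RegularPoly d₀ fun d => mom d.2 Polynomial.X :=
    (RegularPoly.C (Regular.momConst analytic_snd)).add
      ((RegularPoly.C (Regular.momSlope analytic_snd)).mul (.fixed _))
  have hc : RegularPoly d₀ fun d => cof d.2 d.1 Polynomial.X :=
    (RegularPoly.C (Regular.cofConst analytic_snd analytic_fst)).add
      ((RegularPoly.C (Regular.cofSlope analytic_snd analytic_fst)).mul (.fixed _))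
  exact ((RegularPoly.C h₀.regular_inv_mul).mul ((hm.mul hc).add (.C
    ((Regular.momConst analytic_fst).mul (Regular.cofConst analytic_fst analytic_snd))))).neg

theorem regular_conicIm (h₀ : RegularPoint d₀) : RegularPoly d₀ fun d => conicIm d :=
  (RegularPoly.C (h₀.regular_inv_mul.mul
    (((Regular.momSlope analytic_fst).mul (Regular.cofConst analytic_fst analytic_snd)).add
      ((Regular.momConst analytic_fst).mul (Regular.cofSlope analytic_fst analytic_snd))))).neg

end RegularPoint

namespace RegularConic

variable {d₀ : LinkData} {z w : ∀ d, Conic d}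

theorem const {c : LinkData → ℝ} (hc : Regular d₀ c) :
    RegularConic d₀ fun d => algebraMap ℝ (Conic d) (c d) :=
  ⟨.C hc, .fixed 0⟩

theorem add (hz : RegularConic d₀ z) (hw : RegularConic d₀ w) :
    RegularConic d₀ fun d => z d + w d :=
  ⟨hz.1.add hw.1, hz.2.add hw.2⟩

theorem neg (hz : RegularConic d₀ z) : RegularConic d₀ fun d => -z d :=
  ⟨hz.1.neg, hz.2.neg⟩

theorem sub (hz : RegularConic d₀ z) (hw : RegularConic d₀ w) :
    RegularConic d₀ fun d => z d - w d := by
  simpa only [sub_eq_add_neg] using hz.add hw.neg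

theorem mul (h₀ : RegularPoint d₀) (hz : RegularConic d₀ z) (hw : RegularConic d₀ w) :
    RegularConic d₀ fun d => z d * w d := by
  constructor
  · simp only [QuadraticAlgebra.re_mul]
    exact (hz.1.mul hw.1).add ((h₀.regular_conicRe.mul hz.2).mul hw.2)
  · simp only [QuadraticAlgebra.im_mul]
    exact ((hz.1.mul hw.2).add (hz.2.mul hw.1)).add ((h₀.regular_conicIm.mul hz.2).mul hw.2)

theorem smul (h₀ : RegularPoint d₀) {c : LinkData → ℝ} (hc : Regular d₀ c)
    (hz : RegularConic d₀ z) : RegularConic d₀ fun d => c d • z d := by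
  simpa only [Algebra.smul_def] using (const hc).mul h₀ hz

theorem dot (h₀ : RegularPoint d₀) {x y : ∀ d, Fin 3 → Conic d}
    (hx : ∀ i, RegularConic d₀ fun d => x d i) (hy : ∀ i, RegularConic d₀ fun d => y d i) :
    RegularConic d₀ fun d => x d ⬝ᵥ y d := by
  simp only [dot_eq]
  exact (((hx 0).mul h₀ (hy 0)).add ((hx 1).mul h₀ (hy 1))).add ((hx 2).mul h₀ (hy 2))

theorem cross (h₀ : RegularPoint d₀) {x y : ∀ d, Fin 3 → Conic d}
    (hx : ∀ i, RegularConic d₀ fun d => x d i) (hy : ∀ i, RegularConic d₀ fun d => y d i)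
    (i : Fin 3) : RegularConic d₀ fun d => (x d ⨯₃ y d) i := by
  fin_cases i <;> simp only [Fin.zero_eta, Fin.mk_one, Fin.reduceFinMk]
  · simp only [cross_zero]
    exact ((hx 1).mul h₀ (hy 2)).sub ((hx 2).mul h₀ (hy 1))
  · simp only [cross_one]
    exact ((hx 2).mul h₀ (hy 0)).sub ((hx 0).mul h₀ (hy 2))
  · simp only [cross_two]
    exact ((hx 0).mul h₀ (hy 1)).sub ((hx 1).mul h₀ (hy 0))

theorem emb {v : LinkData → Fin 3 → ℝ} (hv : ∀ i, Regular d₀ fun d => v d i) (i : Fin 3) :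
    RegularConic d₀ fun d => emb (Conic d) (v d) i := const (hv i)

theorem rho₁ : RegularConic d₀ cρ₁ := ⟨.fixed 0, .fixed 1⟩

theorem rho₂ : RegularConic d₀ cρ₂ := ⟨.fixed Polynomial.X, .fixed 0⟩

theorem vJ (h₀ : RegularPoint d₀) (i : Fin 3) :
    RegularConic d₀ fun d => vJ d (cρ₁ d) (cρ₂ d) i := by
  have h₁ : RegularConic d₀ fun d => cρ₁ d ^ 2 := by
    simpa only [pow_two] using rho₁.mul h₀ rho₁
  have h₂ : RegularConic d₀ fun d => cρ₂ d ^ 2 := by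
    simpa only [pow_two] using rho₂.mul h₀ rho₂
  exact (((((h₂.mul h₀ (emb (Regular.vE analytic_snd) i)).sub
    (h₁.mul h₀ (emb (Regular.vE analytic_fst) i))).add
    (rho₂.mul h₀ (emb (Regular.vF analytic_snd) i))).sub
    (rho₁.mul h₀ (emb (Regular.vF analytic_fst) i))).add
    (emb (Regular.vG analytic_snd) i)).sub (emb (Regular.vG analytic_fst) i)

theorem regular_dCross (i : Fin 3) : Regular d₀ fun d => dCross d i :=
  Regular.cross (Regular.vD analytic_fst) (Regular.vD analytic_snd) i

theorem rhoDot₁ (h₀ : RegularPoint d₀) :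
    RegularConic d₀ fun d => rhoDot₁ d (cρ₁ d) (cρ₂ d) :=
  smul h₀ ((Regular.dot regular_dCross regular_dCross).inv h₀.dCross_ne)
    (dot h₀ (cross h₀ (vJ h₀) (emb (Regular.vD analytic_snd))) (emb regular_dCross))

theorem rhoDot₂ (h₀ : RegularPoint d₀) :
    RegularConic d₀ fun d => rhoDot₂ d (cρ₁ d) (cρ₂ d) :=
  smul h₀ ((Regular.dot regular_dCross regular_dCross).inv h₀.dCross_ne)
    (dot h₀ (cross h₀ (vJ h₀) (emb (Regular.vD analytic_fst))) (emb regular_dCross))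

theorem pos (h₀ : RegularPoint d₀) {a : LinkData → EpochData}
    (ha : AnalyticOnNhd ℝ a Set.univ) (hz : RegularConic d₀ z) (i : Fin 3) :
    RegularConic d₀ fun d => pos (a d) (z d) i :=
  (hz.mul h₀ (emb (Regular.eRho ha) i)).add (emb (Regular.obsPos ha) i)

theorem vel (h₀ : RegularPoint d₀) {a : LinkData → EpochData}
    (ha : AnalyticOnNhd ℝ a Set.univ) (hz : RegularConic d₀ z) (hw : RegularConic d₀ w)
    (i : Fin 3) : RegularConic d₀ fun d => vel (a d) (z d) (w d) i :=
  ((hw.mul h₀ (emb (Regular.eRho ha) i)).add (hz.mul h₀ (emb (Regular.eta ha) i))).add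
    (emb (Regular.obsVel ha) i)

theorem redLenz (h₀ : RegularPoint d₀) {a : LinkData → EpochData}
    (ha : AnalyticOnNhd ℝ a Set.univ) (hz : RegularConic d₀ z) (hw : RegularConic d₀ w)
    (i : Fin 3) : RegularConic d₀ fun d => redLenz (a d) (z d) (w d) i := by
  have hv := vel h₀ ha hz hw
  have hr := pos h₀ ha hz
  exact ((smul h₀ (.const (1 / 2)) (dot h₀ hv hv)).mul h₀ (hr i)).sub
    ((dot h₀ hr hv).mul h₀ (hv i))

theorem xiElim (h₀ : RegularPoint d₀) (i : Fin 3) :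
    RegularConic d₀ fun d => xiElim d (cρ₁ d) (cρ₂ d) i := by
  simp only [Linkage.xiElim, xi_eq]
  exact cross h₀ (fun j => (redLenz h₀ analytic_fst rho₁ (rhoDot₁ h₀) j).sub
      (redLenz h₀ analytic_snd rho₂ (rhoDot₂ h₀) j))
    (fun j => (pos h₀ analytic_fst rho₁ j).sub (pos h₀ analytic_snd rho₂ j)) i

theorem cp₁ (h₀ : RegularPoint d₀) : RegularConic d₀ cp₁ := by
  rw [show Linkage.cp₁ = _ from funext cp₁_eq]
  exact dot h₀ (xiElim h₀) (emb (Regular.eRho analytic_fst))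

theorem cp₂ (h₀ : RegularPoint d₀) : RegularConic d₀ cp₂ := by
  rw [show Linkage.cp₂ = _ from funext cp₂_eq]
  exact dot h₀ (xiElim h₀) (emb (Regular.eRho analytic_snd))

end RegularConic

theorem RegularPoint.regular_tPoly {d₀ : LinkData} (h₀ : RegularPoint d₀) :
    RegularPoly d₀ tPoly :=
  (RegularPoly.C ((Regular.momSlope analytic_fst).inv h₀.momSlope₁_ne)).mul
    (RegularConic.cp₁ h₀).2

theorem RegularPoint.regular_sPoly {d₀ : LinkData} (h₀ : RegularPoint d₀) :
    RegularPoly d₀ sPoly :=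
  ((RegularPoly.C ((Regular.cofSlope analytic_fst analytic_snd).inv h₀.cofSlope₁_ne)).mul
    (RegularConic.cp₂ h₀).2).neg

theorem regularPoint_sampleData : RegularPoint sampleData where
  dCross_ne := Sample.dCross_ne
  momSlope₁_ne := by simp [Sample.momSlope₁]
  cofSlope₁_ne := by simp [Sample.cofSlope₁]

/-- The resultant for formal degrees is still a polynomial combination of p and r; dividing by it
gives a Bézout relation. -/
theorem isCoprime_of_resultant_ne_zero {p r : ℝ[X]} {m n : ℕ} (hp : p.natDegree ≤ m)
    (hr : r.natDegree ≤ n) (hmn : m ≠ 0 ∨ n ≠ 0) (h : p.resultant r m n ≠ 0) :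
    IsCoprime p r := by
  obtain ⟨a, b, -, -, hab⟩ := Polynomial.exists_mul_add_mul_eq_C_resultant p r hp hr hmn
  refine ⟨Polynomial.C (p.resultant r m n)⁻¹ * a, Polynomial.C (p.resultant r m n)⁻¹ * b, ?_⟩
  rw [← C_inv_mul h, ← hab]
  ring

/-- Each condition is the nonvanishing of a regular function that is nonzero at `sampleData`.
Coprimality of s and t is replaced by the nonvanishing of their resultant at formal degrees 4, 4. -/
theorem genericAt_nonDeg : GenericAt sampleData NonDeg := by
  have h₀ := regularPoint_sampleData
  have f₁ : GenericAt sampleData fun d => dCross d ⬝ᵥ dCross d ≠ 0 :=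
    (Regular.dot RegularConic.regular_dCross RegularConic.regular_dCross).genericAt h₀.dCross_ne
  have f₂ : GenericAt sampleData fun d => baseVolume d ≠ 0 :=
    (Regular.dot (fun i => (Regular.obsPos analytic_fst i).sub (Regular.obsPos analytic_snd i))
      (Regular.cross (Regular.eRho analytic_fst) (Regular.eRho analytic_snd))).genericAt
      Sample.baseVolume_ne
  have f₃ : GenericAt sampleData fun d => momSlope d.1 ≠ 0 :=
    (Regular.momSlope analytic_fst).genericAt h₀.momSlope₁_ne
  have f₄ : GenericAt sampleData fun d => momSlope d.2 ≠ 0 :=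
    (Regular.momSlope analytic_snd).genericAt (by simp [Sample.momSlope₂])
  have f₅ : GenericAt sampleData fun d => cofSlope d.1 d.2 ≠ 0 :=
    (Regular.cofSlope analytic_fst analytic_snd).genericAt h₀.cofSlope₁_ne
  have f₆ : GenericAt sampleData fun d =>
      momConst d.2 * cofSlope d.2 d.1 - momSlope d.2 * cofConst d.2 d.1 ≠ 0 :=
    (((Regular.momConst analytic_snd).mul (Regular.cofSlope analytic_snd analytic_fst)).sub
      ((Regular.momSlope analytic_snd).mul (Regular.cofConst analytic_snd analytic_fst))).genericAt
      (by rw [Sample.momConst₂, Sample.momSlope₂, Sample.cofConst₂, Sample.cofSlope₂]; norm_num)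
  have f₇ : GenericAt sampleData fun d => (sPoly d).resultant (tPoly d) 4 4 ≠ 0 :=
    (h₀.regular_sPoly.resultant h₀.regular_tPoly 4 4).genericAt Sample.resultant_ne_zero
  have f₈ : GenericAt sampleData fun d =>
      momSlope d.1 * momSlope d.2 * (tPoly d).coeff 4 ^ 2 +
        cofSlope d.1 d.2 * cofSlope d.2 d.1 * (sPoly d).coeff 4 ^ 2 ≠ 0 :=
    ((((Regular.momSlope analytic_fst).mul (Regular.momSlope analytic_snd)).mul
      ((h₀.regular_tPoly 4).pow 2)).add
      (((Regular.cofSlope analytic_fst analytic_snd).mul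
        (Regular.cofSlope analytic_snd analytic_fst)).mul
        ((h₀.regular_sPoly 4).pow 2))).genericAt (by
      rw [Sample.coeff_tPoly, Sample.coeff_sPoly, Sample.cofSlope₁, Sample.cofSlope₂]
      norm_num)
  exact (f₁.and (f₂.and (f₃.and (f₄.and (f₅.and (f₆.and (f₇.and f₈))))))).mono
    fun d ⟨e₁, e₂, e₃, e₄, e₅, e₆, e₇, e₈⟩ => ⟨e₁, e₂, e₃, e₄, e₅, e₆,
      isCoprime_of_resultant_ne_zero (natDegree_sPoly_le d) (natDegree_tPoly_le d)
        (Or.inl (by norm_num)) e₇, e₈⟩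

end Linkage

end

theorem mainTheorem1 :
    Linkage.Generic fun d : Linkage.LinkData =>
      ∀ u : ℝ[X], Associated u (Linkage.uPoly d) →
        u.natDegree = 9 ∧
        ∃ g : Fin 6 → Linkage.Poly6,
          Function.Injective g ∧
          Linkage.IsGroebnerBasis MonomialOrder.lex (Linkage.keplerIdeal d) g ∧
          g 5 = Polynomial.aeval Linkage.xρ₂ u :=
  (Linkage.genericAt_nonDeg.mono fun _ hd _ hu => hd.groebner hu).generic
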